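/- **Conventions.** Compact spaces are Hausdorff. For a compact space $K$, $\mathrm{P}(K)$ is the set of regular Borel probability measures on $K$ with the weak* topology. A topological groupoid $\mathcal{G}$ is a Hausdorff space with a continuous, associative, partially defined product on a set $\mathcal{G}^{(2)}$ of composable pairs and a continuous inverse map such that $(g^{-1},g),(g,g^{-1})\in\mathcal{G}^{(2)}$, $g^{-1}(gh)=h$ for $(g,h)\in\mathcal{G}^{(2)}$ and $(hg)g^{-1}=h$ for $(h,g)\in\mathcal{G}^{(2)}$; $s(g)=g^{-1}g$, $r(g)=gg^{-1}$, and $\mathcal{G}^{(0)}=s(\mathcal{G})$ is the unit space with the subspace topology. A groupoid action $(K,q,\mathcal{G})$ consists of a compact space $K$, a continuous open surjection $q\colon K\to\mathcal{G}^{(0)}$ with fibers $K_u=q^{-1}(u)$, and a continuous map $(g,x)\mapsto gx\in K$ defined for $s(g)=q(x)$, with $q(gx)=r(g)$, $(gh)x=g(hx)$ for $(g,h)\in\mathcal{G}^{(2)}$ and $q(x)=s(h)$, and $ux=x$ for $u\in\mathcal{G}^{(0)}$, $x\in K_u$. * $(K,q,\mathcal{G})$ is *pseudoisometric* if there is a set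 $P$ of continuous functions $p\colon K\times_q K\to[0,\infty)$ on $K\times_qK=\{(x,y): q(x)=q(y)\}$ that restrict to pseudometrics on every fiber $K_u$, generate the topology of every fiber, and satisfy $p(gx,gy)=p(x,y)$ for all $g\in\mathcal{G}$ and $x,y\in K_{s(g)}$. * A *factor* of $(K,q,\mathcal{G})$ is a groupoid action $(M,t,\mathcal{H})$ together with a continuous surjection $p\colon K\to M$ and a surjective continuous groupoid homomorphism $\Phi\colon\mathcal{G}\to\mathcal{H}$ with $t(p(x))=\Phi(q(x))$ and $p(gx)=\Phi(g)p(x)$. It is *trivial* if $\mathcal{H}$ is a compact space regarded as a groupoid consisting of units only. $(K,q,\mathcal{G})$ is *topologically ergodic* if for every trivial factor $(M,t,\mathcal{H})$ the space $M$ is a point. * A *relatively invariant measure* for $(K,q,\mathcal{G})$ is a continuous map $\mu\colon\mathcal{G}^{(0)}\to\mathrm{P}(K)$, $u\mapsto\mu_u$, with $q_*\mu_u=\delta_u$ for all $u$ and $g_*\mu_{s(g)}=\mu_{r(g)}$ for all $g\in\mathcal{G}$, where $\mu_{s(g)}$ is regarded as a measure on $K_{s(g)}$. It is *fully supported* if $\operatorname{supp}\mu_u=K_u$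 for all $u$. A topological dynamical system $(K,G)$ is a continuous action of a Hausdorff topological group $G$ on a non-empty compact space $K$; it is *topologically ergodic* if every continuous $G$-invariant function $f\colon K\to\mathbb{C}$ is constant. An *open extension* $q\colon(K,G)\to(L,G)$ is a continuous, open, $G$-equivariant surjection; it is *pseudoisometric* if there is a set $P$ of continuous functions $p\colon K\times_qK\to[0,\infty)$ that restrict to pseudometrics on every fiber $K_l=q^{-1}(l)$, generate the topology of every fiber, and satisfy $p(gx,gy)=p(x,y)$ for all $g\in G$ and $(x,y)\in K\times_q K$. A *relatively invariant measure* for $q$ is a weak*-continuous map $\mu\colon L\to\mathrm{P}(K)$ with $\operatorname{supp}\mu_l\subseteq K_l$ and $g_*\mu_l=\mu_{gl}$ for all $g\in G$, $l\in L$; it is *fully supported* if $\operatorname{supp}\mu_l=K_l$ for all $l\in L$. **Theorem.** 1. Let $(K,q,\mathcal{G})$ be a pseudoisometric and topologically ergodic groupoid action. Then there is a unique relatively invariant measure for $(K,q,\mathcal{G})$, and this relatively invariant measure is fully supported. 2. Every open pseudoisometric extension $q\colon(K,G)\to(L,G)$ of topologically ergodic topological dynamical systems has a unique relatively invariant measure,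 and this relatively invariant measure is fully supported. -/

import Mathlib

open MeasureTheory Topology
open scoped NNReal

/-- A topological groupoid structure on the space `Γ`: a partially defined, associative product on a
set `comp` of composable pairs and an everywhere defined inverse map, both continuous, on a Hausdorff
space. -/
structure TopGroupoid (Γ : Type*) [TopologicalSpace Γ] where
  /-- the set of composable pairs -/
  comp : Set (Γ × Γ)
  /-- the product map -/
  mul : comp → Γ
  /-- the inverse map -/
  inv : Γ → Γ
  comp_mul_left : ∀ {g h k : Γ} (hgh : (g, h) ∈ comp), (h, k) ∈ comp → (mul ⟨(g, h), hgh⟩, k) ∈ comp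
  comp_mul_right : ∀ {g h k : Γ}, (g, h) ∈ comp → ∀ hhk : (h, k) ∈ comp,
    (g, mul ⟨(h, k), hhk⟩) ∈ comp
  mul_assoc : ∀ {g h k : Γ} (hgh : (g, h) ∈ comp) (hhk : (h, k) ∈ comp),
    mul ⟨(mul ⟨(g, h), hgh⟩, k), comp_mul_left hgh hhk⟩ =
      mul ⟨(g, mul ⟨(h, k), hhk⟩), comp_mul_right hgh hhk⟩
  inv_comp : ∀ g : Γ, (inv g, g) ∈ comp
  inv_mul_cancel : ∀ {g h : Γ} (hgh : (g, h) ∈ comp),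
    mul ⟨(inv g, mul ⟨(g, h), hgh⟩), comp_mul_right (inv_comp g) hgh⟩ = h
  comp_inv : ∀ g : Γ, (g, inv g) ∈ comp
  mul_inv_cancel : ∀ {h g : Γ} (hhg : (h, g) ∈ comp),
    mul ⟨(mul ⟨(h, g), hhg⟩, inv g), comp_mul_left hhg (comp_inv g)⟩ = h
  t2Space : T2Space Γ
  continuous_mul : Continuous mul
  continuous_inv : Continuous inv

namespace TopGroupoid

variable {Γ : Type*} [TopologicalSpace Γ] (𝒢 : TopGroupoid Γ)

theorem mul_congr {g h g' h' : Γ} (hg : g = g') (hh : h = h') (c : (g, h) ∈ 𝒢.comp)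
    (c' : (g', h') ∈ 𝒢.comp) : 𝒢.mul ⟨(g, h), c⟩ = 𝒢.mul ⟨(g', h'), c'⟩ := by
  subst hg; subst hh; rfl

/-- The unit space, with the subspace topology. -/
def units : Set Γ := Set.range fun g => 𝒢.mul ⟨(𝒢.inv g, g), 𝒢.inv_comp g⟩

/-- The source map `g ↦ g⁻¹ g`. -/
def s (g : Γ) : 𝒢.units := ⟨𝒢.mul ⟨(𝒢.inv g, g), 𝒢.inv_comp g⟩, g, rfl⟩

theorem mul_inv_eq (g : Γ) : 𝒢.mul ⟨(g, 𝒢.inv g), 𝒢.comp_inv g⟩ =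
    𝒢.mul ⟨(𝒢.inv (𝒢.inv g), 𝒢.inv g), 𝒢.inv_comp (𝒢.inv g)⟩ := by
  have h1 := 𝒢.inv_mul_cancel (𝒢.inv_comp g)
  rw [← 𝒢.mul_assoc (𝒢.inv_comp (𝒢.inv g)) (𝒢.inv_comp g)] at h1
  have h4 := 𝒢.mul_inv_cancel (𝒢.comp_mul_left (𝒢.inv_comp (𝒢.inv g)) (𝒢.inv_comp g))
  rw [← h4]
  exact 𝒢.mul_congr h1.symm rfl _ _

theorem inv_inv (g : Γ) : 𝒢.inv (𝒢.inv g) = g := by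
  have h2 := 𝒢.mul_inv_cancel (𝒢.comp_inv g)
  have h3 := 𝒢.inv_mul_cancel (𝒢.comp_inv (𝒢.inv g))
  rw [← 𝒢.mul_assoc (𝒢.inv_comp (𝒢.inv g)) (𝒢.comp_inv (𝒢.inv g))] at h3
  refine h3.symm.trans (Eq.trans ?_ h2)
  exact 𝒢.mul_congr (𝒢.mul_inv_eq g).symm rfl _ _

/-- The range map `g ↦ g g⁻¹`. -/
def r (g : Γ) : 𝒢.units :=
  ⟨𝒢.mul ⟨(g, 𝒢.inv g), 𝒢.comp_inv g⟩, 𝒢.inv g, (𝒢.mul_inv_eq g).symm⟩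

theorem s_eq_r {g h : Γ} (c : (g, h) ∈ 𝒢.comp) : 𝒢.s g = 𝒢.r h := by
  apply Subtype.ext
  have h1 := 𝒢.inv_mul_cancel (𝒢.comp_mul_right c (𝒢.comp_inv h))
  refine Eq.trans ?_ h1
  refine 𝒢.mul_congr rfl ?_ _ _
  rw [← 𝒢.mul_assoc c (𝒢.comp_inv h)]
  exact (𝒢.mul_inv_cancel c).symm

theorem s_mul {g h : Γ} (c : (g, h) ∈ 𝒢.comp) : 𝒢.s (𝒢.mul ⟨(g, h), c⟩) = 𝒢.s h := by
  rw [𝒢.s_eq_r (𝒢.comp_mul_left c (𝒢.comp_inv h))]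
  exact Subtype.ext (𝒢.mul_congr rfl (𝒢.inv_inv h) _ _)

theorem s_unit (u : 𝒢.units) : 𝒢.s u = u := by
  obtain ⟨_, g, rfl⟩ := u
  exact 𝒢.s_mul (𝒢.inv_comp g)

end TopGroupoid

/-- A Hausdorff space `H` as a trivial groupoid: `x` and `y` are composable only if `x = y`, and
`x x = x = x⁻¹`. -/
def trivialGroupoid (H : Type*) [TopologicalSpace H] [T2Space H] : TopGroupoid H where
  comp := {z | z.1 = z.2}
  mul z := z.1.1
  inv x := x
  comp_mul_left := fun hgh hhk => Eq.trans hgh hhk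
  comp_mul_right := fun hgh _ => hgh
  mul_assoc := fun _ _ => rfl
  inv_comp _ := rfl
  inv_mul_cancel := fun hgh => hgh
  comp_inv _ := rfl
  mul_inv_cancel := fun _ => rfl
  t2Space := inferInstance
  continuous_mul := continuous_fst.comp continuous_subtype_val
  continuous_inv := continuous_id

/-- An action of the topological groupoid `𝒢` on the space `K` along the continuous open surjection
`q` onto the unit space. (Compactness and the Hausdorff property of `K` are imposed separately.) -/
structure GroupoidAction {Γ : Type*} [TopologicalSpace Γ] (𝒢 : TopGroupoid Γ)
    (K : Type*) [TopologicalSpace K] where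
  q : K → 𝒢.units
  continuous_q : Continuous q
  isOpenMap_q : IsOpenMap q
  surjective_q : Function.Surjective q
  /-- the action map on the fiber product of `Γ` and `K` along the source map and `q` -/
  act : {z : Γ × K // 𝒢.s z.1 = q z.2} → K
  continuous_act : Continuous act
  q_act : ∀ z, q (act z) = 𝒢.r z.1.1
  mul_act : ∀ {g h : Γ} (c : (g, h) ∈ 𝒢.comp) (x : K) (hx : 𝒢.s h = q x),
    act ⟨(𝒢.mul ⟨(g, h), c⟩, x), (𝒢.s_mul c).trans hx⟩ =
      act ⟨(g, act ⟨(h, x), hx⟩), (𝒢.s_eq_r c).trans (q_act ⟨(h, x), hx⟩).symm⟩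
  unit_act : ∀ x : K, act ⟨((q x : Γ), x), 𝒢.s_unit (q x)⟩ = x

/-- The map `K_{s(g)} → K`, `x ↦ g x`. -/
def GroupoidAction.translate {Γ : Type*} [TopologicalSpace Γ] {𝒢 : TopGroupoid Γ}
    {K : Type*} [TopologicalSpace K] (A : GroupoidAction 𝒢 K) (g : Γ)
    (x : A.q ⁻¹' {𝒢.s g}) : K :=
  A.act ⟨(g, x.1), x.2.symm⟩

theorem GroupoidAction.q_translate {Γ : Type*} [TopologicalSpace Γ] {𝒢 : TopGroupoid Γ}
    {K : Type*} [TopologicalSpace K] (A : GroupoidAction 𝒢 K) (g : Γ) (x : A.q ⁻¹' {𝒢.s g}) :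
    A.q (A.translate g x) = 𝒢.r g :=
  A.q_act _

/-- A factor map from a groupoid action onto another one: a continuous surjection `p` of the spaces
and a surjective continuous homomorphism `Φ` of the groupoids which are compatible with the
projections to the unit spaces and with the actions. -/
structure FactorMap {Γ Δ : Type*} [TopologicalSpace Γ] [TopologicalSpace Δ]
    {𝒢 : TopGroupoid Γ} {ℋ : TopGroupoid Δ} {K M : Type*} [TopologicalSpace K] [TopologicalSpace M]
    (A : GroupoidAction 𝒢 K) (B : GroupoidAction ℋ M) where
  p : K → M
  Φ : Γ → Δ
  continuous_p : Continuous p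
  surjective_p : Function.Surjective p
  continuous_Φ : Continuous Φ
  surjective_Φ : Function.Surjective Φ
  map_mul : ∀ {g h : Γ} (c : (g, h) ∈ 𝒢.comp), ∃ c' : (Φ g, Φ h) ∈ ℋ.comp,
    Φ (𝒢.mul ⟨(g, h), c⟩) = ℋ.mul ⟨(Φ g, Φ h), c'⟩
  q_p : ∀ x : K, (B.q (p x) : Δ) = Φ (A.q x)
  map_act : ∀ (g : Γ) (x : K) (hx : 𝒢.s g = A.q x), ∃ hx' : ℋ.s (Φ g) = B.q (p x),
    p (A.act ⟨(g, x), hx⟩) = B.act ⟨(Φ g, p x), hx'⟩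

/-- A groupoid action is topologically ergodic if each of its trivial factors (compact Hausdorff
spaces acted on by a compact trivial groupoid) is a point. Up to isomorphism every space that is a
factor of `K` lives in the universe of `K`. -/
def GroupoidAction.TopologicallyErgodic.{u, v} {Γ : Type u} [TopologicalSpace Γ]
    {𝒢 : TopGroupoid Γ} {K : Type v} [TopologicalSpace K] (A : GroupoidAction 𝒢 K) : Prop :=
  ∀ (M H : Type v) [TopologicalSpace M] [CompactSpace M] [T2Space M]
    [TopologicalSpace H] [CompactSpace H] [T2Space H]
    (B : GroupoidAction (trivialGroupoid H) M), FactorMap A B → Nonempty (Unique M)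

/-- The fiber product of `K` with itself along `q`. -/
abbrev FiberProd {K L : Type*} (q : K → L) : Type _ := {z : K × K // q z.1 = q z.2}

/-- `P` is a set of continuous functions on the fiber product which are pseudometrics on each fiber
of `q`, and on each fiber these pseudometrics generate the topology. -/
def GeneratesFibers {K L : Type*} [TopologicalSpace K] (q : K → L)
    (P : Set C(FiberProd q, ℝ≥0)) : Prop :=
  (∀ p ∈ P,
    (∀ x : K, p ⟨(x, x), rfl⟩ = 0) ∧
    (∀ (x y : K) (h : q x = q y), p ⟨(x, y), h⟩ = p ⟨(y, x), h.symm⟩) ∧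
    (∀ (x y z : K) (h : q x = q y) (h' : q y = q z),
      p ⟨(x, z), h.trans h'⟩ ≤ p ⟨(x, y), h⟩ + p ⟨(y, z), h'⟩)) ∧
  ∀ l : L, (instTopologicalSpaceSubtype : TopologicalSpace (q ⁻¹' {l})) =
    TopologicalSpace.generateFrom
      {B | ∃ p ∈ P, ∃ (x : q ⁻¹' {l}) (ε : ℝ≥0), 0 < ε ∧
        B = {y : q ⁻¹' {l} | p ⟨(x.1, y.1), x.2.trans y.2.symm⟩ < ε}}

/-- The groupoid action is pseudoisometric: some set of invariant pseudometrics as above exists. -/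
def GroupoidAction.Pseudoisometric {Γ : Type*} [TopologicalSpace Γ] {𝒢 : TopGroupoid Γ}
    {K : Type*} [TopologicalSpace K] (A : GroupoidAction 𝒢 K) : Prop :=
  ∃ P : Set C(FiberProd A.q, ℝ≥0), GeneratesFibers A.q P ∧
    ∀ p ∈ P, ∀ (g : Γ) (x y : A.q ⁻¹' {𝒢.s g}),
      p ⟨(A.translate g x, A.translate g y), (A.q_translate g x).trans (A.q_translate g y).symm⟩ =
        p ⟨(x.1, y.1), x.2.trans y.2.symm⟩

/-- The regular Borel probability measures on `K`. The topology is that of convergence of the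
integrals of all (bounded) continuous functions, i.e. the weak* topology for compact `K`. -/
abbrev RegularProb (K : Type*) [TopologicalSpace K] [MeasurableSpace K] : Type _ :=
  {μ : ProbabilityMeasure K // (μ : Measure K).Regular}

/-- The underlying measure. -/
abbrev RegularProb.meas {K : Type*} [TopologicalSpace K] [MeasurableSpace K]
    (μ : RegularProb K) : Measure K := (μ.1 : Measure K)

/-- Relatively invariant measures of a groupoid action. In `map_translate`, the measure `μ (s g)` is
viewed as a measure on the fiber `K_{s(g)}`, on which it is concentrated by `map_q`; as `g` is
invertible, pushing `μ (s g)` forward to `μ (r g)` amounts to pulling `μ (r g)` back to `μ (s g)`. -/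
structure GroupoidAction.IsRelInvMeasure {Γ : Type*} [TopologicalSpace Γ] {𝒢 : TopGroupoid Γ}
    {K : Type*} [TopologicalSpace K] [MeasurableSpace K] [BorelSpace K]
    (A : GroupoidAction 𝒢 K) (μ : 𝒢.units → RegularProb K) : Prop where
  continuous : Continuous μ
  map_q : ∀ u, @Measure.map K 𝒢.units _ (borel 𝒢.units) A.q (μ u).meas =
    @Measure.dirac 𝒢.units (borel 𝒢.units) u
  map_translate : ∀ g : Γ,
    Measure.map (A.translate g) (Measure.comap Subtype.val (μ (𝒢.s g)).meas) = (μ (𝒢.r g)).meas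

/-- Each `μ l` has the whole fiber over `l` as its support. -/
def FullySupported {K L : Type*} [TopologicalSpace K] [MeasurableSpace K] (q : K → L)
    (μ : L → RegularProb K) : Prop :=
  ∀ l, (μ l).meas.support = q ⁻¹' {l}

/-- The action of `G` on `K` is topologically ergodic: the fixed space of the Koopman representation
consists of the constant functions. -/
def TopologicallyErgodicSystem (G K : Type*) [Group G] [TopologicalSpace K] [MulAction G K] : Prop :=
  ∀ f : C(K, ℂ), (∀ (g : G) (x : K), f (g⁻¹ • x) = f x) → ∃ c : ℂ, ∀ x, f x = c

/-- `q` is an open extension of topological dynamical systems with acting group `G`. -/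
structure IsOpenExtension (G : Type*) {K L : Type*} [Group G] [TopologicalSpace K]
    [TopologicalSpace L] [MulAction G K] [MulAction G L] (q : K → L) : Prop where
  continuous : Continuous q
  surjective : Function.Surjective q
  isOpenMap : IsOpenMap q
  map_smul : ∀ (g : G) (x : K), q (g • x) = g • q x

/-- The extension `q` is pseudoisometric. -/
def IsOpenExtension.Pseudoisometric {G K L : Type*} [Group G] [TopologicalSpace K]
    [TopologicalSpace L] [MulAction G K] [MulAction G L] {q : K → L} (hq : IsOpenExtension G q) :
    Prop :=
  ∃ P : Set C(FiberProd q, ℝ≥0), GeneratesFibers q P ∧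
    ∀ p ∈ P, ∀ (g : G) (x y : K) (h : q x = q y),
      p ⟨(g • x, g • y), by rw [hq.map_smul, hq.map_smul, h]⟩ = p ⟨(x, y), h⟩

/-- Relatively invariant measures of an extension of topological dynamical systems. -/
structure IsRelInvMeasureExt (G : Type*) {K L : Type*} [Group G] [TopologicalSpace K]
    [TopologicalSpace L] [MulAction G K] [MulAction G L] [MeasurableSpace K] [BorelSpace K]
    (q : K → L) (μ : L → RegularProb K) : Prop where
  continuous : Continuous μ
  support_subset : ∀ l, (μ l).meas.support ⊆ q ⁻¹' {l}
  map_smul : ∀ (g : G) (l : L),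
    Measure.map (fun x : K => g • x) (μ l).meas = (μ (g • l)).meas

/-! Both statements concern one structure: bijections between the fibers of an open surjection `q`
(`FiberMoves`) such that invariant continuous functions on `K` are constant and invariant
pseudometrics separate the points of each fiber. The proof adapts the construction of Haar measure.
Call a probability measure on a fiber uniform if the integral of k(x, ·) is the same for all x in
the fiber, for every invariant kernel k; the basic kernels are max(ε - d, 0) with d an invariant
pseudometric.

Uniqueness of the uniform measure on a fiber is a Fubini argument (`IsUniformMeasure.integral_eq`):
for k concentrated near the diagonal, the double integral of f(y) k(x, y) is a constant times the
integral of f against one measure, and nearly the same constant times the integral against the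
other.

Existence rests on `Ergodic.exists_net`. Two ε-nets of a fiber with least cardinality can be matched
within 2ε by Hall's theorem, so the averages of k(x, ·) over them nearly agree. A continuous
invariant weight detects nets. The maximum, over families S in the fiber of x, of the weight of S
times the sum of k(x, S a) is continuous and invariant in x, hence constant by ergodicity. For a net
of greatest weight this makes the averages nearly independent of x. An ultralimit and the Riesz
theorem then give a uniform measure.

Limits of uniform means are uniform because `q` is open, so uniqueness makes the family of uniform
measures continuous. The bijections carry uniform measures to uniform ones, so uniqueness also makes
it invariant. Conversely, for an invariant continuous family ν the integral of k(x, ·) against ν at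
q x is continuous and invariant in x, hence constant, so ν consists of the uniform measures. -/

/-! ### Maxima over fibers -/

open Filter Set in
/-- If `q` is open and `Y` is compact, the maximum of a continuous function over the fibers of `q`
depends continuously on the parameters. -/
theorem exists_continuous_isGreatest_fiber {Z Y L : Type*} [TopologicalSpace Z] [TopologicalSpace Y]
    [TopologicalSpace L] [CompactSpace Y] [T2Space L] {q : Y → L} (hq : Continuous q)
    (hqo : IsOpenMap q) (hqs : Function.Surjective q) {b : Z → L} (hb : Continuous b)
    {φ : Z → Y → ℝ} (hφ : Continuous φ.uncurry) :
    ∃ F : Z → ℝ, Continuous F ∧ ∀ z, IsGreatest (φ z '' (q ⁻¹' {b z})) (F z) := by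
  have hex : ∀ z, ∃ a, IsGreatest (φ z '' (q ⁻¹' {b z})) a := fun z => by
    have hc : IsCompact (q ⁻¹' {b z}) := (isClosed_singleton.preimage hq).isCompact
    obtain ⟨y, hy⟩ := hqs (b z)
    have hφz : Continuous (φ z) := hφ.comp (Continuous.prodMk_right z)
    exact (hc.image hφz).exists_isGreatest ⟨_, y, hy, rfl⟩
  choose F hF using hex
  refine ⟨F, ?_, hF⟩
  rw [continuous_iff_lower_upperSemicontinuous]
  constructor
  -- Openness of `q`: a nearly maximal point over b z has nearby points in all nearby fibers.
  · rw [lowerSemicontinuous_iff_isOpen_preimage]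
    intro a
    rw [isOpen_iff_mem_nhds]
    intro z hz
    obtain ⟨y, hy, hyF⟩ := (hF z).1
    have h1 : ∀ᶠ p : Z × Y in 𝓝 (z, y), a < φ.uncurry p :=
      hφ.continuousAt.eventually (lt_mem_nhds (by simpa [hyF] using hz))
    rw [nhds_prod_eq] at h1
    obtain ⟨U, hU, V, hV, hUV⟩ := mem_prod_iff.1 h1
    have h2 : q '' V ∈ 𝓝 (b z) := by
      rw [← (show q y = b z from hy)]; exact hqo.image_mem_nhds hV
    filter_upwards [hU, hb.continuousAt h2] with z' hz' hbz'
    obtain ⟨y', hy', hqy'⟩ := hbz'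
    have h3 : a < φ z' y' := hUV (Set.mk_mem_prod hz' hy')
    exact h3.trans_le ((hF z').2 ⟨y', hqy', rfl⟩)
  -- Compactness of `Y`: superlevel sets are projections of closed sets along a compact factor.
  · rw [upperSemicontinuous_iff_isClosed_preimage]
    intro a
    have h : F ⁻¹' Ici a = Prod.fst '' {p : Z × Y | q p.2 = b p.1 ∧ a ≤ φ p.1 p.2} := by
      ext z
      constructor
      · intro hz
        obtain ⟨y, hy, hyF⟩ := (hF z).1
        exact ⟨(z, y), ⟨hy, hyF ▸ hz⟩, rfl⟩
      · rintro ⟨⟨z, y⟩, ⟨hy, hay⟩, rfl⟩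
        exact hay.trans ((hF z).2 ⟨y, hy, rfl⟩)
    rw [h]
    refine isClosedMap_fst_of_compactSpace _ (IsClosed.inter ?_ ?_)
    · exact isClosed_eq (hq.comp continuous_snd) (hb.comp continuous_fst)
    · exact isClosed_le continuous_const hφ

/-! ### Means on fibers -/

/-- A mean concentrated on `X`: a normalized linear functional on `C(K, ℝ)` which is nonnegative on
functions that are nonnegative on `X`. -/
structure IsMeanOn {K : Type*} [TopologicalSpace K] (X : Set K) (m : C(K, ℝ) → ℝ) : Prop where
  map_add : ∀ f g, m (f + g) = m f + m g
  map_smul : ∀ (c : ℝ) f, m (c • f) = c * m f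
  nonneg : ∀ f, (∀ x ∈ X, 0 ≤ f x) → 0 ≤ m f
  map_one : m 1 = 1

namespace IsMeanOn

variable {K : Type*} [TopologicalSpace K] {X : Set K} {m : C(K, ℝ) → ℝ}

theorem map_sub (h : IsMeanOn X m) (f g : C(K, ℝ)) : m (f - g) = m f - m g := by
  have h1 : f - g = f + (-1 : ℝ) • g := by ext; simp [sub_eq_add_neg]
  rw [h1, h.map_add, h.map_smul]; ring

theorem mono (h : IsMeanOn X m) {f g : C(K, ℝ)} (hfg : ∀ x ∈ X, f x ≤ g x) : m f ≤ m g := by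
  have := h.nonneg (g - f) fun x hx => by simpa using hfg x hx
  rw [h.map_sub] at this; linarith

theorem map_const (h : IsMeanOn X m) (c : ℝ) : m (ContinuousMap.const K c) = c := by
  have h1 : ContinuousMap.const K c = c • (1 : C(K, ℝ)) := by ext; simp
  rw [h1, h.map_smul, h.map_one, mul_one]

theorem le_const (h : IsMeanOn X m) {f : C(K, ℝ)} {c : ℝ} (hf : ∀ x ∈ X, f x ≤ c) : m f ≤ c :=
  (h.mono (g := ContinuousMap.const K c) hf).trans_eq (h.map_const c)

theorem abs_sub_le (h : IsMeanOn X m) {f g : C(K, ℝ)} {c : ℝ} (hfg : ∀ x ∈ X, |f x - g x| ≤ c) :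
    |m f - m g| ≤ c := by
  rw [abs_le]
  constructor
  · have := h.le_const (f := g - f) (c := c) fun x hx => by
      have := (abs_le.1 (hfg x hx)).1; simp; linarith
    rw [h.map_sub] at this; linarith
  · have := h.le_const (f := f - g) (c := c) fun x hx => by
      have := (abs_le.1 (hfg x hx)).2; simpa using this
    rw [h.map_sub] at this; linarith

theorem abs_sub_le_norm [CompactSpace K] (h : IsMeanOn X m) (f g : C(K, ℝ)) :
    |m f - m g| ≤ ‖f - g‖ :=
  h.abs_sub_le fun x _ => by simpa using (f - g).norm_coe_le_norm x

theorem abs_le_norm [CompactSpace K] (h : IsMeanOn X m) (f : C(K, ℝ)) : |m f| ≤ ‖f‖ := by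
  have h0 : m 0 = 0 := by simpa using h.map_smul 0 0
  simpa [h0] using h.abs_sub_le_norm f 0

theorem continuous [CompactSpace K] (h : IsMeanOn X m) : Continuous m :=
  (LipschitzWith.of_dist_le_mul (K := 1) fun f g => by
    simpa [Real.dist_eq, dist_eq_norm] using h.abs_sub_le_norm f g).continuous

/-- The mean over a finite family of points. -/
theorem of_average {n : ℕ} (hn : n ≠ 0) {S : Fin n → K} (hS : ∀ a, S a ∈ X) :
    IsMeanOn X fun f => (∑ a, f (S a)) / n where
  map_add f g := by simp [Finset.sum_add_distrib, add_div]
  map_smul c f := by simp [← Finset.mul_sum, mul_div_assoc]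
  nonneg f hf := div_nonneg (Finset.sum_nonneg fun a _ => hf _ (hS a)) (Nat.cast_nonneg n)
  map_one := by simp [hn]

theorem of_measure [CompactSpace K] [MeasurableSpace K] [BorelSpace K] {μ : Measure K}
    [IsProbabilityMeasure μ] (hμ : μ Xᶜ = 0) : IsMeanOn X fun f => ∫ x, f x ∂μ where
  map_add f g := integral_add (f.continuous.integrable_of_hasCompactSupport
    (.of_compactSpace _)) (g.continuous.integrable_of_hasCompactSupport (.of_compactSpace _))
  map_smul c f := integral_const_mul c _
  nonneg f hf := integral_nonneg_of_ae <| by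
    filter_upwards [show ∀ᵐ x ∂μ, x ∈ X from hμ] with x hx using hf x hx
  map_one := by simp

/-- The Riesz–Markov–Kakutani theorem for means. -/
theorem exists_regularProb [CompactSpace K] [T2Space K] [MeasurableSpace K] [BorelSpace K]
    (h : IsMeanOn X m) (hX : IsClosed X) :
    ∃ μ : RegularProb K, μ.meas Xᶜ = 0 ∧ ∀ f : C(K, ℝ), ∫ x, f x ∂μ.meas = m f := by
  let Λ : CompactlySupportedContinuousMap K ℝ →ₚ[ℝ] ℝ :=
  { toFun g := m g.toContinuousMap
    map_add' g g' := h.map_add _ _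
    map_smul' c g := h.map_smul _ _
    monotone' g g' hgg' := h.mono fun x _ => hgg' x }
  have hint : ∀ f : C(K, ℝ), ∫ x, f x ∂(RealRMK.rieszMeasure Λ) = m f := fun f =>
    RealRMK.integral_rieszMeasure Λ ⟨f, .of_compactSpace _⟩
  have hprob : IsProbabilityMeasure (RealRMK.rieszMeasure Λ) := by
    have h1 := hint 1
    simp only [ContinuousMap.one_apply, integral_const, smul_eq_mul, mul_one, h.map_one] at h1
    exact ⟨by simpa [Measure.real, ENNReal.toReal_eq_one_iff] using h1⟩
  refine ⟨⟨⟨_, hprob⟩, RealRMK.regular_rieszMeasure Λ⟩, ?_, hint⟩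
  change RealRMK.rieszMeasure Λ Xᶜ = 0
  -- By inner regularity it suffices to bound compact sets off `X`, using a Urysohn function that
  -- vanishes on `X`.
  rw [hX.isOpen_compl.measure_eq_iSup_isCompact]
  simp only [ENNReal.iSup_eq_zero]
  intro C hCX hC
  obtain ⟨f, hf0, hf1, hf01⟩ := exists_continuous_zero_one_of_isClosed hX hC.isClosed
    (Set.subset_compl_iff_disjoint_left.1 hCX)
  have hmf : m f ≤ 0 := h.le_const fun x hx => (hf0 hx).le
  rw [← hint f] at hmf
  have hfi : Integrable f (RealRMK.rieszMeasure Λ) :=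
    f.continuous.integrable_of_hasCompactSupport (.of_compactSpace _)
  have h2 : (RealRMK.rieszMeasure Λ).real C ≤ ∫ x, f x ∂(RealRMK.rieszMeasure Λ) := by
    rw [← integral_indicator_one hC.measurableSet]
    refine integral_mono ((integrable_const 1).indicator hC.measurableSet) hfi fun x => ?_
    by_cases hx : x ∈ C
    · simp [hx, hf1 hx]
    · simp [hx, (hf01 x).1]
  have h3 : (RealRMK.rieszMeasure Λ).real C = 0 := le_antisymm (h2.trans hmf) measureReal_nonneg
  exact (measureReal_eq_zero_iff).1 h3

/-- Ultralimits of means on fibers of `q`. -/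
theorem exists_ultralimit {L ι : Type*} [TopologicalSpace L] [T2Space L] [CompactSpace K]
    {q : K → L} (hq : Continuous q) (U : Ultrafilter ι) {l : ι → L} {l₀ : L}
    (hl : Filter.Tendsto l U (𝓝 l₀)) {m : ι → C(K, ℝ) → ℝ}
    (hm : ∀ i, IsMeanOn (q ⁻¹' {l i}) (m i)) :
    ∃ m₀, IsMeanOn (q ⁻¹' {l₀}) m₀ ∧ ∀ f, Filter.Tendsto (fun i => m i f) U (𝓝 (m₀ f)) := by
  have hex : ∀ f, ∃ a, Filter.Tendsto (fun i => m i f) U (𝓝 a) := fun f => by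
    obtain ⟨a, -, ha⟩ := (isCompact_Icc (a := -‖f‖) (b := ‖f‖)).ultrafilter_le_nhds
      (U.map fun i => m i f) (by
        rw [Filter.le_principal_iff, Ultrafilter.coe_map, Filter.mem_map]
        exact Filter.Eventually.of_forall fun i => abs_le.1 ((hm i).abs_le_norm f))
    exact ⟨a, ha⟩
  choose m₀ hm₀ using hex
  refine ⟨m₀, ⟨fun f g => ?_, fun c f => ?_, fun f hf => ?_, ?_⟩, hm₀⟩
  · refine tendsto_nhds_unique (hm₀ _) (((hm₀ f).add (hm₀ g)).congr fun i => ?_)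
    rw [(hm i).map_add]
  · refine tendsto_nhds_unique (hm₀ _) (((hm₀ f).const_mul c).congr fun i => ?_)
    rw [(hm i).map_smul]
  · refine le_of_forall_pos_lt_add fun δ hδ => ?_
    -- The fibers on which f drops to -δ/2 form a closed set of base points missing `l₀`, so `l i`
    -- eventually avoids it.
    have hcl : IsClosed (q '' {x | f x ≤ -(δ / 2)}) :=
      ((isClosed_le f.continuous continuous_const).isCompact.image hq).isClosed
    have hev : ∀ᶠ i in (U : Filter ι), l i ∉ q '' {x | f x ≤ -(δ / 2)} := by
      refine hl (hcl.isOpen_compl.mem_nhds ?_)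
      rintro ⟨x, hx, hxl⟩
      have := hf x hxl
      simp only [Set.mem_ofPred_eq] at hx
      linarith
    have : -(δ / 2) ≤ m₀ f := by
      refine ge_of_tendsto (hm₀ f) (hev.mono fun i hi => ?_)
      rw [← (hm i).map_const (-(δ / 2))]
      refine (hm i).mono fun x hx => ?_
      by_contra hcon
      exact hi ⟨x, (not_le.1 hcon).le, hx⟩
    linarith
  · exact tendsto_nhds_unique (hm₀ 1) (tendsto_const_nhds.congr fun i => ((hm i).map_one).symm)

end IsMeanOn

/-! ### Invariant kernels and pseudometrics -/

/-- A family of bijections between fibers of `q : K → L`. Each of them is given as a map `K → K`, of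
which only the values on the fiber over `src j` matter. -/
structure FiberMoves {K L : Type*} (q : K → L) (J : Type*) where
  src : J → L
  tgt : J → L
  map : J → K → K
  q_map : ∀ j x, q x = src j → q (map j x) = tgt j
  surj : ∀ j y, q y = tgt j → ∃ x, q x = src j ∧ map j x = y

namespace FiberMoves

section Defs

variable {K L J : Type*} [TopologicalSpace K] {q : K → L} (T : FiberMoves q J)

/-- Continuous invariant functions are constant. -/
def Ergodic : Prop :=
  ∀ f : C(K, ℝ), (∀ j x, q x = T.src j → f (T.map j x) = f x) → ∀ x y, f x = f y

/-- A function on `K × K` that is invariant on pairs of points of one fiber. -/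
def Preserves (k : C(K × K, ℝ)) : Prop :=
  ∀ j x y, q x = T.src j → q y = T.src j → k (T.map j x, T.map j y) = k (x, y)

/-- Nonnegative, symmetric and invariant functions on pairs of points of one fiber. -/
structure IsKernel (k : C(K × K, ℝ)) : Prop where
  nonneg : ∀ z, 0 ≤ k z
  symm : ∀ x y, q x = q y → k (x, y) = k (y, x)
  preserves : T.Preserves k

/-- Continuous functions which restrict to an invariant pseudometric on fibers. -/
structure IsPseudo (d : C(K × K, ℝ)) : Prop where
  nonneg : ∀ x y, q x = q y → 0 ≤ d (x, y)
  self : ∀ x, d (x, x) = 0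
  symm : ∀ x y, q x = q y → d (x, y) = d (y, x)
  triangle : ∀ x y z, q x = q y → q y = q z → d (x, z) ≤ d (x, y) + d (y, z)
  preserves : T.Preserves d

/-- The invariant pseudometrics separate the points of each fiber. -/
def Separates : Prop :=
  ∀ x y, q x = q y → x ≠ y → ∃ d, T.IsPseudo d ∧ 0 < d (x, y)

variable {T}

theorem IsPseudo.zero : T.IsPseudo 0 where
  nonneg _ _ _ := le_rfl
  self _ := rfl
  symm _ _ _ := rfl
  triangle _ _ _ _ _ := by simp
  preserves _ _ _ _ _ := rfl

theorem IsPseudo.add {d e : C(K × K, ℝ)} (hd : T.IsPseudo d) (he : T.IsPseudo e) :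
    T.IsPseudo (d + e) where
  nonneg x y h := add_nonneg (hd.nonneg x y h) (he.nonneg x y h)
  self x := by simp [hd.self, he.self]
  symm x y h := by simp [hd.symm x y h, he.symm x y h]
  triangle x y z h h' := by
    have := hd.triangle x y z h h'
    have := he.triangle x y z h h'
    simp only [ContinuousMap.add_apply]; linarith
  preserves j x y hx hy := by simp [hd.preserves j x y hx hy, he.preserves j x y hx hy]

/-- The function `max (ε - d) 0`. -/
def bump (d : C(K × K, ℝ)) (ε : ℝ) : C(K × K, ℝ) :=
  ⟨fun z => max (ε - d z) 0, by fun_prop⟩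

theorem bump_apply (d : C(K × K, ℝ)) (ε : ℝ) (z : K × K) : bump d ε z = max (ε - d z) 0 := rfl

theorem bump_pos {d : C(K × K, ℝ)} {ε : ℝ} {z : K × K} : 0 < bump d ε z ↔ d z < ε := by
  simp [bump_apply]

theorem IsPseudo.isKernel_bump {d : C(K × K, ℝ)} (hd : T.IsPseudo d) (ε : ℝ) :
    T.IsKernel (bump d ε) where
  nonneg _ := le_max_right _ _
  symm x y h := by simp [bump_apply, hd.symm x y h]
  preserves j x y hx hy := by simp [bump_apply, hd.preserves j x y hx hy]

end Defs

/-! ### Uniform continuity along fibers -/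

section Uniform

variable {K L J : Type*} [TopologicalSpace K] [CompactSpace K] [TopologicalSpace L] [T2Space L]
  {q : K → L} {T : FiberMoves q J}

/-- Continuous functions are uniformly continuous on fibers with respect to the invariant
pseudometrics. -/
theorem Separates.exists_uniform (hT : T.Separates) (hq : Continuous q) {Z : Type*}
    [TopologicalSpace Z] [CompactSpace Z] (h : C(Z × K, ℝ)) {δ : ℝ} (hδ : 0 < δ) :
    ∃ d, T.IsPseudo d ∧ ∃ ε > 0, ∀ x y y', q y = q y' → d (y, y') < ε →
      |h (x, y) - h (x, y')| < δ := by
  let C : Set (Z × K × K) := {w | q w.2.1 = q w.2.2 ∧ δ ≤ |h (w.1, w.2.1) - h (w.1, w.2.2)|}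
  have hC : IsCompact C := by
    refine IsClosed.isCompact (IsClosed.inter ?_ ?_)
    · exact isClosed_eq (hq.comp (continuous_fst.comp continuous_snd))
        (hq.comp (continuous_snd.comp continuous_snd))
    · exact isClosed_le continuous_const
        (g := fun w : Z × K × K => |h (w.1, w.2.1) - h (w.1, w.2.2)|) (by fun_prop)
  have hd : ∃ d, T.IsPseudo d ∧ ∀ w ∈ C, 0 < d w.2 := by
    -- Positivity is only claimed on `C`: a sum of pseudometrics stays positive because the other
    -- summand is nonnegative on pairs of one fiber.
    refine hC.induction_on (p := fun D => ∃ d, T.IsPseudo d ∧ ∀ w ∈ D ∩ C, 0 < d w.2)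
      ⟨0, .zero, by simp⟩ ?_ ?_ ?_ |>.imp fun d hd => ⟨hd.1, fun w hw => hd.2 w ⟨hw, hw⟩⟩
    · rintro A B hAB ⟨d, hd, hB⟩
      exact ⟨d, hd, fun w hw => hB w ⟨hAB hw.1, hw.2⟩⟩
    · rintro A B ⟨d, hd, hA⟩ ⟨e, he, hB⟩
      refine ⟨d + e, hd.add he, ?_⟩
      rintro ⟨x, y, y'⟩ ⟨hw | hw, hwC⟩
      · exact add_pos_of_pos_of_nonneg (hA _ ⟨hw, hwC⟩) (he.nonneg _ _ hwC.1)
      · exact add_pos_of_nonneg_of_pos (hd.nonneg _ _ hwC.1) (hB _ ⟨hw, hwC⟩)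
    · rintro ⟨x, y, y'⟩ ⟨hyy, hxy⟩
      have hne : y ≠ y' := by
        rintro rfl
        simp at hxy; linarith
      obtain ⟨d, hd, hpos⟩ := hT y y' hyy hne
      refine ⟨{w | 0 < d w.2}, mem_nhdsWithin_of_mem_nhds ?_, d, hd, fun w hw => hw.1⟩
      exact (isOpen_lt continuous_const (by fun_prop)).mem_nhds hpos
  obtain ⟨d, hd, hdC⟩ := hd
  obtain ⟨ε, hε, hεC⟩ : ∃ ε > 0, ∀ w ∈ C, ε ≤ d w.2 := by
    obtain hemp | hne := C.eq_empty_or_nonempty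
    · exact ⟨1, one_pos, by simp [hemp]⟩
    · obtain ⟨w, hw, hmin⟩ := hC.exists_isMinOn hne (f := fun w => d w.2) (by fun_prop)
      exact ⟨d w.2, hdC w hw, fun w' hw' => hmin hw'⟩
  refine ⟨d, hd, ε, hε, fun x y y' hyy hlt => ?_⟩
  by_contra hcon
  exact absurd hlt (not_lt.2 (hεC (x, y, y') ⟨hyy, not_lt.1 hcon⟩))

/-- On pairs of one fiber a sum of pseudometrics dominates each summand, so finitely many moduli of
continuity combine into one. -/
theorem Separates.exists_uniform_finset (hT : T.Separates) (hq : Continuous q)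
    (𝒦 : Finset C(K × K, ℝ)) {δ : ℝ} (hδ : 0 < δ) :
    ∃ d, T.IsPseudo d ∧ ∃ ε > 0, ∀ k ∈ 𝒦, ∀ x y y', q y = q y' → d (y, y') < ε →
      |k (x, y) - k (x, y')| < δ := by
  classical
  induction 𝒦 using Finset.induction with
  | empty => exact ⟨0, .zero, 1, one_pos, by simp⟩
  | insert k s hk ih =>
    obtain ⟨d, hd, ε, hε, h⟩ := ih
    obtain ⟨d', hd', ε', hε', h'⟩ := hT.exists_uniform hq k hδ
    refine ⟨d + d', hd.add hd', min ε ε', lt_min hε hε', ?_⟩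
    intro k₁ hk₁ x y y' hyy hlt
    have h1 := hd.nonneg y y' hyy
    have h2 := hd'.nonneg y y' hyy
    simp only [ContinuousMap.add_apply, lt_min_iff] at hlt
    obtain rfl | hk₁ := Finset.mem_insert.1 hk₁
    · exact h' x y y' hyy (by linarith)
    · exact h k₁ hk₁ x y y' hyy (by linarith)

end Uniform

/-! ### Minimal nets and matchings -/

section Nets

variable {K L J : Type*} [TopologicalSpace K] {q : K → L} {T : FiberMoves q J}

/-- `S` is an `ε`-net of the fiber over `l` with respect to `d`. -/
def IsNet (q : K → L) (d : C(K × K, ℝ)) (ε : ℝ) (l : L) {ι : Type*} (S : ι → K) : Prop :=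
  (∀ a, q (S a) = l) ∧ ∀ y, q y = l → ∃ a, d (S a, y) < ε

theorem IsNet.comp_equiv {d : C(K × K, ℝ)} {ε : ℝ} {l : L} {ι ι' : Type*} {S : ι → K}
    (hS : IsNet q d ε l S) (e : ι' ≃ ι) : IsNet q d ε l (S ∘ e) :=
  ⟨fun a => hS.1 (e a), fun y hy => (hS.2 y hy).elim fun a ha => ⟨e.symm a, by simpa using ha⟩⟩

/-- Two nets of minimal cardinality can be matched. -/
theorem IsPseudo.exists_matching {d : C(K × K, ℝ)} (hd : T.IsPseudo d) {ε : ℝ} {l : L} {n : ℕ}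
    (hmin : ∀ m < n, ∀ S : Fin m → K, ¬ IsNet q d ε l S) {S S' : Fin n → K}
    (hS : IsNet q d ε l S) (hS' : IsNet q d ε l S') :
    ∃ σ : Fin n ≃ Fin n, ∀ a, d (S a, S' (σ a)) < 2 * ε := by
  classical
  let t : Fin n → Finset (Fin n) := fun a => {b | d (S a, S' b) < 2 * ε}
  -- Hall's condition: if `A` had too few neighbours, replacing the points of `S` indexed by `A`
  -- with those neighbours would give a smaller net. A point within ε of S a, a in `A`, is within ε
  -- of some S' b, and this b is a neighbour of a.
  have hall : ∀ A : Finset (Fin n), A.card ≤ (A.biUnion t).card := by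
    intro A
    by_contra! hlt
    let S₁ : {a // a ∈ Aᶜ} ⊕ {b // b ∈ A.biUnion t} → K := Sum.elim (fun a => S a) fun b => S' b
    have hS₁ : IsNet q d ε l S₁ := by
      refine ⟨?_, fun y hy => ?_⟩
      · rintro (a | b)
        exacts [hS.1 _, hS'.1 _]
      · obtain ⟨a, ha⟩ := hS.2 y hy
        by_cases haA : a ∈ A
        · obtain ⟨b, hb⟩ := hS'.2 y hy
          have hqa := hS.1 a
          have hqb := hS'.1 b
          have hab : d (S a, S' b) < 2 * ε := by
            have h1 := hd.triangle (S a) y (S' b) (hqa.trans hy.symm) (hy.trans hqb.symm)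
            rw [hd.symm y (S' b) (hy.trans hqb.symm)] at h1
            linarith
          refine ⟨Sum.inr ⟨b, Finset.mem_biUnion.2 ⟨a, haA, ?_⟩⟩, hb⟩
          simpa [t] using hab
        · exact ⟨Sum.inl ⟨a, Finset.mem_compl.2 haA⟩, ha⟩
    refine hmin _ ?_ _ (hS₁.comp_equiv (Fintype.equivFin _).symm)
    have hA : A.card ≤ n := by simpa using A.card_le_univ
    simp only [Fintype.card_sum, Fintype.card_coe, Finset.card_compl, Fintype.card_fin]
    omega
  obtain ⟨f, hf, hft⟩ := (Finset.all_card_le_biUnion_card_iff_exists_injective t).1 hall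
  exact ⟨Equiv.ofBijective f (Finite.injective_iff_bijective.1 hf), fun a => by
    simpa [t] using hft a⟩

theorem IsPseudo.exists_isNet [CompactSpace K] [TopologicalSpace L] [T1Space L] (hq : Continuous q)
    {d : C(K × K, ℝ)} (hd : T.IsPseudo d) {ε : ℝ} (hε : 0 < ε) (l : L) :
    ∃ n, ∃ S : Fin n → K, IsNet q d ε l S := by
  have hc : IsCompact (q ⁻¹' {l}) := (isClosed_singleton.preimage hq).isCompact
  obtain ⟨t, ht, hcov⟩ := hc.elim_nhds_subcover (fun x => {y | d (x, y) < ε}) fun x _ =>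
    (isOpen_lt (by fun_prop) continuous_const).mem_nhds (by simpa [hd.self] using hε)
  refine ⟨_, _, IsNet.comp_equiv (S := fun a : t => (a : K)) ⟨fun a => ht a a.2, fun y hy => ?_⟩
    t.equivFin.symm⟩
  simpa using hcov hy

end Nets

end FiberMoves

/-! ### Nearly constant averages from ergodicity -/

namespace FiberMoves

variable {K L J : Type*} [TopologicalSpace K] [CompactSpace K] [TopologicalSpace L] [T2Space L]
  {q : K → L} {T : FiberMoves q J}

/-- A continuous function of a net in the fiber over `l` which is positive exactly at `ε`-nets, and
which is invariant. -/
theorem IsPseudo.exists_weight {d : C(K × K, ℝ)} (hd : T.IsPseudo d) (ε : ℝ) (hq : Continuous q)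
    (hqo : IsOpenMap q) (hqs : Function.Surjective q) (n : ℕ) :
    ∃ W : L × (Fin n → K) → ℝ, Continuous W ∧
      (∀ l S, (∀ a, q (S a) = l) → (0 < W (l, S) ↔ IsNet q d ε l S)) ∧
      ∀ j S, (∀ a, q (S a) = T.src j) → W (T.tgt j, fun a => T.map j (S a)) = W (T.src j, S) := by
  -- The weight is the minimum over y in the fiber of the sum of bumps at (S a, y); it is positive
  -- exactly when every y is within ε of some S a.
  obtain ⟨F, hF, hFmax⟩ := exists_continuous_isGreatest_fiber hq hqo hqs
    (Z := L × (Fin n → K)) (b := Prod.fst) continuous_fst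
    (φ := fun z y => -∑ a, bump d ε (z.2 a, y)) (by
      simp only [Function.uncurry_def]
      fun_prop)
  refine ⟨fun z => -F z, hF.neg, fun l S hS => ?_, fun j S hS => ?_⟩
  · obtain ⟨⟨y₀, hy₀, hFy₀⟩, hle⟩ := hFmax (l, S)
    constructor
    · refine fun hpos => ⟨hS, fun y hy => ?_⟩
      have h1 := hle ⟨y, hy, rfl⟩
      have h2 : ∑ a : Fin n, (0 : ℝ) < ∑ a, bump d ε (S a, y) := by
        simp only [Finset.sum_const_zero]
        dsimp only at h1 hpos
        linarith
      obtain ⟨a, -, ha⟩ := Finset.exists_lt_of_sum_lt h2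
      exact ⟨a, bump_pos.1 ha⟩
    · rintro ⟨-, hnet⟩
      obtain ⟨a, ha⟩ := hnet y₀ hy₀
      change 0 < -F (l, S)
      rw [← hFy₀, neg_neg]
      exact Finset.sum_pos' (fun a _ => (hd.isKernel_bump ε).nonneg _)
        ⟨a, Finset.mem_univ a, bump_pos.2 ha⟩
  · refine congrArg Neg.neg ((hFmax _).unique ?_)
    refine (congrArg (IsGreatest · (F (T.src j, S))) ?_).mpr (hFmax (T.src j, S))
    ext c
    constructor
    · rintro ⟨y', hy', rfl⟩
      obtain ⟨y, hy, rfl⟩ := T.surj j y' hy'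
      refine ⟨y, hy, ?_⟩
      simp only [(hd.isKernel_bump ε).preserves j _ y (hS _) hy]
    · rintro ⟨y, hy, rfl⟩
      refine ⟨T.map j y, T.q_map j y hy, ?_⟩
      simp only [(hd.isKernel_bump ε).preserves j _ y (hS _) hy]

/-- Every fiber has finite families of points over which the averages of a sufficiently uniform
kernel `k (x, ·)` almost do not depend on the point `x` of the fiber. -/
theorem Ergodic.exists_net (hE : T.Ergodic) {d : C(K × K, ℝ)} (hd : T.IsPseudo d) {ε : ℝ}
    (hε : 0 < ε) (hq : Continuous q) (hqo : IsOpenMap q) (hqs : Function.Surjective q) (l : L) :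
    ∃ n : ℕ, n ≠ 0 ∧ ∃ S : Fin n → K, (∀ a, q (S a) = l) ∧ ∀ k, T.IsKernel k → ∀ δ,
      (∀ x y y', q y = q y' → d (y, y') < 2 * ε → |k (x, y) - k (x, y')| < δ) →
      ∀ x x', q x = l → q x' = l → |(∑ a, k (x, S a)) / n - (∑ a, k (x', S a)) / n| ≤ δ := by
  classical
  have hex := hd.exists_isNet hq hε l
  obtain ⟨n, ⟨S₀, hS₀⟩, hmin⟩ : ∃ n, (∃ S : Fin n → K, IsNet q d ε l S) ∧
      ∀ m < n, ∀ S : Fin m → K, ¬ IsNet q d ε l S :=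
    ⟨Nat.find hex, Nat.find_spec hex, fun m hm S hS => Nat.find_min hex hm ⟨S, hS⟩⟩
  have hn : n ≠ 0 := by
    rintro rfl
    obtain ⟨y, hy⟩ := hqs l
    obtain ⟨a, -⟩ := hS₀.2 y hy
    exact a.elim0
  obtain ⟨W, hW, hWnet, hWinv⟩ := hd.exists_weight ε hq hqo hqs n
  let X : Set (Fin n → K) := {S | ∀ a, q (S a) = l}
  have hX : IsCompact X := by
    refine IsClosed.isCompact ?_
    simp only [X, Set.ofPred_forall]
    exact isClosed_iInter fun a => isClosed_eq (hq.comp (continuous_apply a)) continuous_const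
  -- A family of greatest weight over `l`; its choice does not involve the kernel, so it serves all
  -- kernels at once.
  obtain ⟨S, hS, hSmax⟩ := hX.exists_isMaxOn ⟨S₀, hS₀.1⟩ (f := fun S => W (l, S))
    (by fun_prop)
  have hWS : 0 < W (l, S) := ((hWnet l S₀ hS₀.1).2 hS₀).trans_le (hSmax hS₀.1)
  have hSnet := (hWnet l S hS).1 hWS
  refine ⟨n, hn, S, hS, fun k hk δ hkδ => ?_⟩
  have hn0 : (0 : ℝ) < n := by positivity
  suffices H : ∀ x x', q x = l → q x' = l → (∑ a, k (x, S a)) / n - (∑ a, k (x', S a)) / n ≤ δ from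
    fun x x' hx hx' => abs_le.2 ⟨by have := H x' x hx' hx; linarith, H x x' hx hx'⟩
  intro x x' hx hx'
  -- Families in the fiber of x form the fiber of the power of `q` over the constant tuple q x. The
  -- factor `W` stands in for the constraint that S be a net, which is not a closed condition.
  obtain ⟨F, hF, hFmax⟩ := exists_continuous_isGreatest_fiber (Z := K) (Y := Fin n → K)
    (q := Pi.map fun _ => q) (b := fun x _ => q x)
    (Continuous.piMap fun _ => hq) (IsOpenMap.piMap (fun _ => hqo)
      (Filter.Eventually.of_forall fun _ => hqs)) (Function.Surjective.piMap fun _ => hqs)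
    (continuous_pi fun _ => hq) (φ := fun x S => W (q x, S) * ∑ a, k (x, S a)) (by
      simp only [Function.uncurry_def]
      refine Continuous.mul (hW.comp ?_) ?_
      · exact (hq.comp continuous_fst).prodMk continuous_snd
      · fun_prop)
  have hFinv : ∀ j x, q x = T.src j → F (T.map j x) = F x := by
    intro j x hx
    have hqx := T.q_map j x hx
    refine (hFmax _).unique ?_
    refine (congrArg (IsGreatest · (F x)) ?_).mpr (hFmax x)
    have key : ∀ S : Fin n → K, (∀ a, q (S a) = T.src j) →
        W (q (T.map j x), fun a => T.map j (S a)) * ∑ a, k (T.map j x, T.map j (S a)) =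
          W (q x, S) * ∑ a, k (x, S a) := by
      intro S hS
      rw [hqx, hWinv j S hS, hx]
      simp only [hk.preserves j x _ hx (hS _)]
    ext c
    constructor
    · rintro ⟨S', hS', rfl⟩
      have hS'q : ∀ a, q (S' a) = T.tgt j := fun a => (congrFun hS' a).trans hqx
      choose S hS hSS' using fun a => T.surj j (S' a) (hS'q a)
      obtain rfl : (fun a => T.map j (S a)) = S' := funext hSS'
      exact ⟨S, funext fun a => (hS a).trans hx.symm, (key S hS).symm⟩
    · rintro ⟨S, hS, rfl⟩
      have hSq : ∀ a, q (S a) = T.src j := fun a => (congrFun hS a).trans hx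
      exact ⟨fun a => T.map j (S a), funext fun a => (T.q_map j _ (hSq a)).trans hqx.symm,
        key S hSq⟩
  have hxx' := hE ⟨F, hF⟩ hFinv x x'
  simp only [ContinuousMap.coe_mk] at hxx'
  have hle : W (l, S) * ∑ a, k (x, S a) ≤ F x := by
    refine (hFmax x).2 ⟨S, funext fun a => (hS a).trans hx.symm, ?_⟩
    simp only [hx]
  obtain ⟨⟨S', hS', hFS'⟩, -⟩ := hFmax x'
  have hS'q : ∀ a, q (S' a) = l := fun a => (congrFun hS' a).trans hx'
  rw [hxx', ← hFS'] at hle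
  simp only [hx'] at hle
  have hnn : ∀ x (S : Fin n → K), 0 ≤ ∑ a, k (x, S a) := fun x S =>
    Finset.sum_nonneg fun a _ => hk.nonneg _
  have hδ : 0 ≤ δ := by
    have := hkδ x x x rfl (by rw [hd.self]; linarith)
    simp at this; exact this.le
  rw [← sub_div, div_le_iff₀ hn0]
  -- The maximizer `S'` at x' is either a minimal net, and then it can be matched with `S`, or has
  -- weight at most 0, which forces the sum at x to be at most 0.
  by_cases hW' : 0 < W (l, S')
  · obtain ⟨σ, hσ⟩ := hd.exists_matching hmin ((hWnet l S' hS'q).1 hW') hSnet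
    have h1 : ∑ a, k (x', S' a) ≤ ∑ a, k (x', S a) + δ * n := by
      have h2 : ∑ a, k (x', S' a) ≤ ∑ a, (k (x', S (σ a)) + δ) := Finset.sum_le_sum fun a _ => by
        have := (abs_lt.1 (hkδ x' _ _ ((hS'q a).trans (hS (σ a)).symm) (hσ a))).2
        linarith
      rw [Finset.sum_add_distrib, Equiv.sum_comp σ fun a => k (x', S a)] at h2
      simpa [mul_comm] using h2
    have h3 : W (l, S') * ∑ a, k (x', S' a) ≤ W (l, S) * (∑ a, k (x', S a) + δ * n) :=
      mul_le_mul (hSmax hS'q) h1 (hnn _ _) hWS.le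
    have := le_of_mul_le_mul_left (hle.trans h3) hWS
    linarith
  · have h1 : W (l, S) * ∑ a, k (x, S a) ≤ 0 :=
      hle.trans (mul_nonpos_of_nonpos_of_nonneg (not_lt.1 hW') (hnn _ _))
    have h2 := nonpos_of_mul_nonpos_right h1 hWS
    have h3 := hnn x' S
    have : 0 ≤ δ * n := by positivity
    linarith

end FiberMoves

/-! ### Uniform means -/

namespace FiberMoves

section Means

variable {K L J : Type*} [TopologicalSpace K] {q : K → L} (T : FiberMoves q J)

/-- The means of `k (x, ·)` do not depend on the point `x` of the fiber over `l`, for all kernels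
`k`. -/
def IsUniform (l : L) (m : C(K, ℝ) → ℝ) : Prop :=
  ∀ k, T.IsKernel k → ∀ x x', q x = l → q x' = l → m (k.curry x) = m (k.curry x')

variable [CompactSpace K] [TopologicalSpace L] {T}

/-- Since `q` is open, points over `l₀` are approximated by points over `l i`, where the estimate is
known; continuity of `k.curry` carries it back. -/
theorem IsUniform.of_tendsto {ι : Type*} (hqo : IsOpenMap q) {U : Filter ι} [U.NeBot] {l : ι → L}
    {l₀ : L} (hl : Filter.Tendsto l U (𝓝 l₀)) {m : ι → C(K, ℝ) → ℝ}
    (hm : ∀ i, IsMeanOn (q ⁻¹' {l i}) (m i)) {m₀ : C(K, ℝ) → ℝ}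
    (hm₀ : ∀ f, Filter.Tendsto (fun i => m i f) U (𝓝 (m₀ f)))
    (hunif : ∀ k, T.IsKernel k → ∀ δ > 0, ∀ᶠ i in U, ∀ x x', q x = l i → q x' = l i →
      |m i (k.curry x) - m i (k.curry x')| ≤ δ) : T.IsUniform l₀ m₀ := by
  intro k hk x x' hx hx'
  refine eq_of_forall_dist_le fun δ hδ => ?_
  rw [Real.dist_eq]
  have hnear : ∀ x, q x = l₀ → ∀ᶠ i in U, ∃ z, q z = l i ∧ ‖k.curry x - k.curry z‖ < δ / 3 := by
    intro x hx
    have h1 : {z | ‖k.curry x - k.curry z‖ < δ / 3} ∈ 𝓝 x := by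
      refine (isOpen_lt (by fun_prop) continuous_const).mem_nhds ?_
      simp only [Set.mem_ofPred_eq, sub_self, norm_zero]; positivity
    have h2 := hqo.image_mem_nhds h1
    rw [hx] at h2
    filter_upwards [hl h2] with i hi
    obtain ⟨z, hz, hzl⟩ := hi
    exact ⟨z, hzl, hz⟩
  refine le_of_tendsto ((hm₀ _).sub (hm₀ _)).abs ?_
  filter_upwards [hnear x hx, hnear x' hx', hunif k hk (δ / 3) (by positivity)]
    with i ⟨z, hz, hxz⟩ ⟨z', hz', hxz'⟩ hi
  have h1 := abs_le.1 ((hm i).abs_sub_le_norm (k.curry x) (k.curry z))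
  have h2 := abs_le.1 ((hm i).abs_sub_le_norm (k.curry x') (k.curry z'))
  have h3 := abs_le.1 (hi z z' hz hz')
  rw [abs_le]
  constructor <;> linarith

/-- Averages over nets give means that are uniform up to a tolerance for finitely many kernels; an
ultralimit over growing finite sets and shrinking tolerances removes both restrictions. -/
theorem Ergodic.exists_isUniform [T2Space L] (hE : T.Ergodic) (hT : T.Separates) (hq : Continuous q)
    (hqo : IsOpenMap q) (hqs : Function.Surjective q) (l : L) :
    ∃ m, IsMeanOn (q ⁻¹' {l}) m ∧ T.IsUniform l m := by
  have hex : ∀ i : Finset C(K × K, ℝ) × ℕ, ∃ m, IsMeanOn (q ⁻¹' {l}) m ∧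
      ∀ k ∈ i.1, T.IsKernel k → ∀ x x', q x = l → q x' = l →
        |m (k.curry x) - m (k.curry x')| ≤ 1 / ((i.2 : ℝ) + 1) := by
    intro i
    obtain ⟨d, hd, ε, hε, hdε⟩ := hT.exists_uniform_finset hq i.1
      (δ := 1 / ((i.2 : ℝ) + 1)) (by positivity)
    -- Radius ε/2, because matched points are only within twice the radius.
    obtain ⟨n, hn, S, hS, hnet⟩ := hE.exists_net hd (half_pos hε) hq hqo hqs l
    refine ⟨_, IsMeanOn.of_average hn hS, fun k hk hker => hnet k hker _ fun x y y' hy hlt => ?_⟩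
    exact hdε k hk x y y' hy (by linarith)
  choose m hm hunif using hex
  classical
  let U : Ultrafilter (Finset C(K × K, ℝ) × ℕ) := Ultrafilter.of Filter.atTop
  have hU : (U : Filter (Finset C(K × K, ℝ) × ℕ)) ≤ Filter.atTop := Ultrafilter.of_le _
  obtain ⟨m₀, hm₀, hlim⟩ := IsMeanOn.exists_ultralimit hq U tendsto_const_nhds hm
  refine ⟨m₀, hm₀, IsUniform.of_tendsto hqo tendsto_const_nhds hm hlim fun k hk δ hδ => ?_⟩
  obtain ⟨N, hN⟩ := exists_nat_one_div_lt hδ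
  refine hU ((Filter.eventually_ge_atTop ({k}, N)).mono fun i hi x x' hx hx' => ?_)
  have hki : k ∈ i.1 := hi.1 (Finset.mem_singleton_self k)
  have hNi : (N : ℝ) ≤ i.2 := by exact_mod_cast hi.2
  refine (hunif i k hki hk x x' hx hx').trans (le_trans ?_ hN.le)
  gcongr

end Means

/-! ### Uniqueness of uniform measures -/

section Measures

variable {K L J : Type*} [TopologicalSpace K] [MeasurableSpace K] [BorelSpace K] {q : K → L}
  (T : FiberMoves q J)

/-- The measure `μ` is concentrated on the fiber over `l`, and on this fiber the integrals of the
kernels `k (x, ·)` do not depend on `x`. -/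
structure IsUniformMeasure (l : L) (μ : Measure K) : Prop where
  null : μ (q ⁻¹' {l})ᶜ = 0
  uniform : T.IsUniform l fun f => ∫ x, f x ∂μ

variable [CompactSpace K] [TopologicalSpace L] [T2Space L] {T}

theorem integrable_continuousMap (μ : Measure K) [IsFiniteMeasure μ] (f : C(K, ℝ)) :
    Integrable f μ :=
  f.continuous.integrable_of_hasCompactSupport (.of_compactSpace _)

/-- The integrals of bump functions are positive. -/
theorem IsUniformMeasure.integral_bump_pos {l : L} {μ : Measure K} [IsProbabilityMeasure μ]
    (h : T.IsUniformMeasure l μ) (hq : Continuous q) {d : C(K × K, ℝ)} (hd : T.IsPseudo d) {ε : ℝ}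
    (hε : 0 < ε) {x : K} (hx : q x = l) : 0 < ∫ y, bump d ε (x, y) ∂μ := by
  have hnn : ∀ x, 0 ≤ ∫ y, bump d ε (x, y) ∂μ := fun x =>
    integral_nonneg fun y => (hd.isKernel_bump ε).nonneg _
  refine (hnn x).lt_of_ne' fun h0 => ?_
  have hc : IsCompact (q ⁻¹' {l}) := (isClosed_singleton.preimage hq).isCompact
  have hnull : μ (q ⁻¹' {l}) = 0 := by
    -- By uniformity a vanishing integral at x vanishes at every z of the fiber, so every point of
    -- the compact fiber has a null ball around it.
    refine hc.measure_zero_of_nhdsWithin fun z hz => ?_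
    refine ⟨{y | d (z, y) < ε}, mem_nhdsWithin_of_mem_nhds
      ((isOpen_lt (by fun_prop) continuous_const).mem_nhds (by simpa [hd.self] using hε)), ?_⟩
    have hz0 : ∫ y, bump d ε (z, y) ∂μ = 0 :=
      (h.uniform _ (hd.isKernel_bump ε) z x hz hx).trans h0
    rw [integral_eq_zero_iff_of_nonneg (fun y => (hd.isKernel_bump ε).nonneg (z, y))
      (integrable_continuousMap μ ((bump d ε).curry z))] at hz0
    refine measure_mono_null (fun y hy => ?_) hz0
    exact (bump_pos.2 hy).ne'
  have huniv := measure_union_le (μ := μ) (q ⁻¹' {l}) (q ⁻¹' {l})ᶜ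
  rw [Set.union_compl_self, measure_univ, hnull, h.null] at huniv
  simp at huniv

/-- Regular uniform probability measures on the same fiber agree. -/
theorem IsUniformMeasure.integral_eq [T2Space K] (hT : T.Separates) (hq : Continuous q)
    (hqs : Function.Surjective q) {l : L} {μ ν : Measure K} [IsProbabilityMeasure μ]
    [IsProbabilityMeasure ν] (hμ : T.IsUniformMeasure l μ) (hν : T.IsUniformMeasure l ν)
    (f : C(K, ℝ)) : ∫ x, f x ∂μ = ∫ x, f x ∂ν := by
  obtain ⟨x₀, hx₀⟩ := hqs l
  refine eq_of_forall_dist_le fun δ hδ => ?_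
  obtain ⟨d, hd, ε, hε, hfd⟩ := hT.exists_uniform hq (Z := Unit) ⟨fun z => f z.2, by fun_prop⟩ hδ
  set k := bump d ε
  have hk : T.IsKernel k := hd.isKernel_bump ε
  have hμl : ∀ᵐ x ∂μ, q x = l := hμ.null
  have hνl : ∀ᵐ x ∂ν, q x = l := hν.null
  set a := ∫ y, k (x₀, y) ∂μ
  set b := ∫ y, k (x₀, y) ∂ν
  have ha0 : 0 < a := hμ.integral_bump_pos hq hd hε hx₀
  have hμk : ∀ x, q x = l → ∫ y, k (x, y) ∂μ = a := fun x hx => hμ.uniform k hk x x₀ hx hx₀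
  have hνk : ∀ x, q x = l → ∫ y, k (x, y) ∂ν = b := fun x hx => hν.uniform k hk x x₀ hx hx₀
  have hμk' : ∀ y, q y = l → ∫ x, k (x, y) ∂μ = a := fun y hy => by
    rw [← hμk y hy]
    refine integral_congr_ae ?_
    filter_upwards [hμl] with x hx using hk.symm x y (hx.trans hy.symm)
  -- Swap the integrals; by symmetry of k the inner integral over x is the constant a. The swap is
  -- the one for continuous integrands, as `K` need not be second countable.
  have hfub : ∀ g : C(K, ℝ), ∫ x, (∫ y, g y * k (x, y) ∂ν) ∂μ = a * ∫ y, g y ∂ν := by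
    intro g
    rw [integral_integral_swap_of_hasCompactSupport
      (by simp only [Function.uncurry_def]; fun_prop) (.of_compactSpace _),
      ← integral_const_mul]
    refine integral_congr_ae ?_
    filter_upwards [hνl] with y hy
    rw [integral_const_mul, hμk' y hy, mul_comm]
  have hab : b = a := by
    have h1 := hfub 1
    simp only [ContinuousMap.one_apply, one_mul, integral_const, probReal_univ, smul_eq_mul,
      mul_one] at h1
    rw [← h1, integral_congr_ae (g := fun _ => b)]
    · simp
    · filter_upwards [hμl] with x hx using hνk x hx
  -- Where k(x, y) is nonzero, f y differs from f x by less than δ, so the inner integral is within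
  -- δ a of a f x.
  have hmain : |∫ x, (∫ y, f y * k (x, y) ∂ν) ∂μ - a * ∫ x, f x ∂μ| ≤ δ * a := by
    have hJ : Continuous fun x => ∫ y, f y * k (x, y) ∂ν :=
      (IsMeanOn.of_measure hν.null).continuous.comp
        (show Continuous fun x => f * k.curry x by fun_prop)
    have hJi : Integrable (fun x => ∫ y, f y * k (x, y) ∂ν) μ :=
      integrable_continuousMap μ ⟨_, hJ⟩
    rw [← integral_const_mul, ← integral_sub hJi
      ((integrable_continuousMap μ f).const_mul a), ← Real.norm_eq_abs]
    have h1 := norm_integral_le_of_norm_le_const (μ := μ) (C := δ * a)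
      (f := fun x => (∫ y, f y * k (x, y) ∂ν) - a * f x) ?_
    · simpa using h1
    filter_upwards [hμl] with x hx
    have hkx : Integrable (fun y => k (x, y)) ν := integrable_continuousMap ν (k.curry x)
    have hfk : Integrable (fun y => f y * k (x, y)) ν :=
      integrable_continuousMap ν (f * k.curry x)
    have h2 : (∫ y, f y * k (x, y) ∂ν) - a * f x = ∫ y, (f y - f x) * k (x, y) ∂ν := by
      have h3 : ∫ y, f x * k (x, y) ∂ν = a * f x := by
        rw [integral_const_mul, hνk x hx, hab, mul_comm]
      rw [← h3, ← integral_sub hfk (hkx.const_mul _)]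
      simp only [sub_mul]
    rw [h2, ← hab, ← hνk x hx, ← integral_const_mul]
    refine norm_integral_le_of_norm_le (hkx.const_mul _) ?_
    filter_upwards [hνl] with y hy
    rw [norm_mul, Real.norm_eq_abs, Real.norm_eq_abs, abs_of_nonneg (hk.nonneg _)]
    by_cases hxy : d (x, y) < ε
    · have h4 := hfd () x y (hx.trans hy.symm) hxy
      simp only [ContinuousMap.coe_mk] at h4
      rw [abs_sub_comm] at h4
      exact mul_le_mul_of_nonneg_right h4.le (hk.nonneg _)
    · have h5 : k (x, y) = 0 := le_antisymm (not_lt.1 (mt bump_pos.1 hxy)) (hk.nonneg _)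
      simp [h5]
  rw [hfub, ← mul_sub, abs_mul, abs_of_pos ha0, mul_comm δ] at hmain
  rw [dist_comm, Real.dist_eq]
  exact le_of_mul_le_mul_left hmain ha0

end Measures

end FiberMoves

theorem RegularProb.ext_of_integral_eq {K : Type*} [TopologicalSpace K] [T2Space K]
    [CompactSpace K] [MeasurableSpace K] [BorelSpace K] {μ ν : RegularProb K}
    (h : ∀ f : C(K, ℝ), ∫ x, f x ∂μ.meas = ∫ x, f x ∂ν.meas) : μ = ν := by
  have : μ.1.1.Regular := μ.2
  have : ν.1.1.Regular := ν.2
  exact Subtype.ext (Subtype.ext (Measure.ext_of_integral_eq_on_compactlySupported fun f =>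
    h f.toContinuousMap))

/-! ### The continuous family of uniform measures -/

namespace FiberMoves

variable {K L J : Type*} [TopologicalSpace K] [CompactSpace K] [MeasurableSpace K] [BorelSpace K]
  [TopologicalSpace L] {q : K → L} {T : FiberMoves q J}

/-- A separated and ergodic family of fiber bijections has exactly one uniform measure on each
fiber. These measures depend continuously on the fiber, and they are fully supported. -/
theorem Ergodic.exists_uniformMeasure [T2Space K] [T2Space L] (hE : T.Ergodic)
    (hT : T.Separates) (hq : Continuous q) (hqo : IsOpenMap q) (hqs : Function.Surjective q) :
    ∃ μ : L → RegularProb K, Continuous μ ∧ FullySupported q μ ∧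
      (∀ l, T.IsUniformMeasure l (μ l).meas) ∧
      ∀ l (ν : RegularProb K), T.IsUniformMeasure l ν.meas → ν = μ l := by
  have hcl : ∀ l, IsClosed (q ⁻¹' {l}) := fun l => isClosed_singleton.preimage hq
  have hex : ∀ l, ∃ μ : RegularProb K, T.IsUniformMeasure l μ.meas := fun l => by
    obtain ⟨m, hm, hunif⟩ := hE.exists_isUniform hT hq hqo hqs l
    obtain ⟨μ, hμ, hμm⟩ := hm.exists_regularProb (hcl l)
    exact ⟨μ, hμ, fun k hk x x' hx hx' => by simpa only [hμm] using hunif k hk x x' hx hx'⟩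
  choose μ hμ using hex
  have hmean : ∀ l, IsMeanOn (q ⁻¹' {l}) fun f => ∫ x, f x ∂(μ l).meas := fun l =>
    .of_measure (hμ l).null
  refine ⟨μ, ?_, fun l => ?_, hμ, fun l ν hν => ?_⟩
  · refine continuous_induced_rng.2 ?_
    rw [ProbabilityMeasure.continuous_iff_forall_continuousMap_continuous_integral]
    intro f
    rw [continuous_iff_ultrafilter]
    intro l₀ U hU
    -- Any ultralimit of the uniform measures is uniform on the limit fiber, hence equals the
    -- measure already chosen there.
    obtain ⟨m₀, hm₀, hlim⟩ := IsMeanOn.exists_ultralimit hq U (l := id) hU hmean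
    have hunif : T.IsUniform l₀ m₀ :=
      IsUniform.of_tendsto hqo (l := id) hU hmean hlim fun k hk δ hδ =>
        Filter.Eventually.of_forall fun l x x' hx hx' => by
          have := (hμ l).uniform k hk x x' hx hx'
          dsimp only at this
          rw [this, sub_self, abs_zero]; exact hδ.le
    obtain ⟨ν, hν, hνm⟩ := hm₀.exists_regularProb (hcl l₀)
    have hνu : T.IsUniformMeasure l₀ ν.meas :=
      ⟨hν, fun k hk x x' hx hx' => by simpa only [hνm] using hunif k hk x x' hx hx'⟩
    have hfin := hlim f
    rw [← hνm, hνu.integral_eq hT hq hqs (hμ l₀)] at hfin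
    exact hfin
  · refine subset_antisymm (Measure.support_subset_of_isClosed (hcl l) (hμ l).null) fun x hx => ?_
    rw [Measure.mem_support_iff_forall]
    intro V hV
    by_contra! hV0
    obtain ⟨O, hOV, hO, hxO⟩ := mem_nhds_iff.1 hV
    have hO0 : (μ l).meas O = 0 := measure_mono_null hOV (le_antisymm hV0 bot_le)
    obtain ⟨f, hf0, hf1, -⟩ := exists_continuous_zero_one_of_isClosed hO.isClosed_compl
      (isClosed_singleton (x := x)) (by simpa using hxO)
    -- Within the fiber, the d-ball of radius ε at x lies in `O`, since f falls from 1 to 0 outside;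
    -- yet the bump on this ball has positive integral.
    obtain ⟨d, hd, ε, hε, hfd⟩ :=
      hT.exists_uniform hq (Z := Unit) ⟨fun z => f z.2, by fun_prop⟩ one_pos
    refine ((hμ l).integral_bump_pos hq hd hε hx).ne' ?_
    refine integral_eq_zero_of_ae ?_
    have hOc : ∀ᵐ y ∂(μ l).meas, y ∉ O := measure_eq_zero_iff_ae_notMem.1 hO0
    filter_upwards [hOc, show ∀ᵐ y ∂(μ l).meas, q y = l from (hμ l).null] with y hyO hy
    refine le_antisymm (not_lt.1 (mt bump_pos.1 fun hxy => ?_)) ((hd.isKernel_bump ε).nonneg _)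
    have := hfd () x y (hx.trans hy.symm) hxy
    simp [hf0 hyO, hf1 (Set.mem_singleton x)] at this
  · exact RegularProb.ext_of_integral_eq fun f => hν.integral_eq hT hq hqs (hμ l) f

/-- Invariant continuous families of measures are uniform. -/
theorem Ergodic.isUniformMeasure (hE : T.Ergodic) (hq : Continuous q) {ν : L → RegularProb K}
    (hν : Continuous ν) (hnull : ∀ l, (ν l).meas (q ⁻¹' {l})ᶜ = 0)
    (hinv : ∀ j (f : C(K, ℝ)),
      ∫ x, f (T.map j x) ∂(ν (T.src j)).meas = ∫ x, f x ∂(ν (T.tgt j)).meas) (l : L) :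
    T.IsUniformMeasure l (ν l).meas := by
  have hmean : ∀ l, IsMeanOn (q ⁻¹' {l}) fun f => ∫ x, f x ∂(ν l).meas := fun l =>
    .of_measure (hnull l)
  refine ⟨hnull l, fun k hk x x' hx hx' => ?_⟩
  have hF : Continuous fun x => ∫ y, k (x, y) ∂(ν (q x)).meas := by
    rw [continuous_iff_continuousAt]
    intro x₀
    have h1 : Filter.Tendsto (fun x => ∫ y, k.curry x₀ y ∂(ν (q x)).meas) (𝓝 x₀)
        (𝓝 (∫ y, k.curry x₀ y ∂(ν (q x₀)).meas)) :=
      ((ProbabilityMeasure.continuous_integral_continuousMap (k.curry x₀)).comp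
        (continuous_subtype_val.comp (hν.comp hq))).tendsto x₀
    -- Replacing the kernel section at x by that at `x₀` costs at most their sup distance, whatever
    -- the measure.
    have h2 : Filter.Tendsto (fun x => ∫ y, k.curry x y ∂(ν (q x)).meas -
        ∫ y, k.curry x₀ y ∂(ν (q x)).meas) (𝓝 x₀) (𝓝 0) := by
      refine squeeze_zero_norm (a := fun x => ‖k.curry x - k.curry x₀‖)
        (fun x => (hmean (q x)).abs_sub_le_norm _ _) ?_
      have : Continuous fun x => ‖k.curry x - k.curry x₀‖ := by fun_prop
      simpa using this.tendsto x₀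
    have h3 := h2.add h1
    simp only [sub_add_cancel, zero_add] at h3
    exact h3
  have hconst := hE ⟨_, hF⟩ (fun j x hx => ?_) x x'
  · simp only [ContinuousMap.coe_mk, hx, hx'] at hconst
    exact hconst
  · simp only [ContinuousMap.coe_mk, T.q_map j x hx, hx]
    refine (hinv j (k.curry (T.map j x))).symm.trans (integral_congr_ae ?_)
    filter_upwards [show ∀ᵐ y ∂(ν (T.src j)).meas, q y = T.src j from hnull _] with y hy
    exact hk.preserves j x y hx hy

end FiberMoves

/-! ### From generating pseudometrics to separation -/

/-- The pseudometrics of a set generating the topology of the fibers separate the points of each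
fiber. -/
theorem GeneratesFibers.exists_pos {K L : Type*} [TopologicalSpace K] [T2Space K] {q : K → L}
    {P : Set C(FiberProd q, ℝ≥0)} (hP : GeneratesFibers q P) {x y : K} (h : q x = q y)
    (hxy : x ≠ y) : ∃ p ∈ P, 0 < p ⟨(x, y), h⟩ := by
  by_contra! h0
  let x' : q ⁻¹' {q y} := ⟨x, h⟩
  let y' : q ⁻¹' {q y} := ⟨y, rfl⟩
  obtain ⟨U, V, hU, -, hxU, hyV, hUV⟩ := t2_separation (x := x') (y := y')
    fun h => hxy (congrArg Subtype.val h)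
  rw [hP.2 (q y)] at hU
  suffices H : x' ∈ U ↔ y' ∈ U from Set.disjoint_left.1 hUV (H.1 hxU) hyV
  have hU' : TopologicalSpace.GenerateOpen _ U := hU
  clear hU hxU hUV
  induction hU' with
  | basic s hs =>
    obtain ⟨p, hp, z, ε, hε, rfl⟩ := hs
    obtain ⟨-, hsymm, htri⟩ := hP.1 p hp
    have hz : q z.1 = q y := z.2
    have hxy0 : p ⟨(x, y), h⟩ = 0 := le_antisymm (h0 p hp) bot_le
    have hyx0 : p ⟨(y, x), h.symm⟩ = 0 := (hsymm x y h).symm.trans hxy0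
    have h1 := htri z.1 x y (hz.trans h.symm) h
    have h2 := htri z.1 y x hz h.symm
    rw [hxy0, add_zero] at h1
    rw [hyx0, add_zero] at h2
    exact ⟨fun hlt => h1.trans_lt hlt, fun hlt => h2.trans_lt hlt⟩
  | univ => simp
  | inter s t _ _ hs ht => exact and_congr hs ht
  | sUnion S _ hS =>
    exact ⟨fun ⟨s, hs, hx⟩ => ⟨s, hs, (hS s hs).1 hx⟩, fun ⟨s, hs, hy⟩ => ⟨s, hs, (hS s hs).2 hy⟩⟩

/-- Tietze's theorem extends p from the closed fiber product to `K × K`. The extension is controlled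
only on pairs of one fiber, which is all that `IsPseudo` asks for. -/
theorem FiberMoves.separates_of_generatesFibers {K L J : Type*} [TopologicalSpace K]
    [CompactSpace K] [T2Space K] [TopologicalSpace L] [T2Space L] {q : K → L} (hq : Continuous q)
    (T : FiberMoves q J) {P : Set C(FiberProd q, ℝ≥0)} (hP : GeneratesFibers q P)
    (hinv : ∀ p ∈ P, ∀ j x y (hx : q x = T.src j) (hy : q y = T.src j),
      p ⟨(T.map j x, T.map j y), (T.q_map j x hx).trans (T.q_map j y hy).symm⟩ =
        p ⟨(x, y), hx.trans hy.symm⟩) : T.Separates := by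
  intro x y h hxy
  obtain ⟨p, hp, hpos⟩ := hP.exists_pos h hxy
  have hcl : IsClosed {z : K × K | q z.1 = q z.2} :=
    isClosed_eq (hq.comp continuous_fst) (hq.comp continuous_snd)
  obtain ⟨d, hd⟩ := ContinuousMap.exists_extension (X₁ := FiberProd q)
    hcl.isClosedEmbedding_subtypeVal ⟨fun z => (p z : ℝ), by fun_prop⟩
  have hdp : ∀ x y (h : q x = q y), d (x, y) = p ⟨(x, y), h⟩ := fun x y h =>
    DFunLike.congr_fun hd (⟨(x, y), h⟩ : FiberProd q)
  obtain ⟨hself, hsymm, htri⟩ := hP.1 p hp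
  refine ⟨d, ⟨fun x y h => ?_, fun x => ?_, fun x y h => ?_, fun x y z h h' => ?_,
    fun j x y hx hy => ?_⟩, ?_⟩
  · rw [hdp x y h]; positivity
  · rw [hdp x x rfl, hself]; rfl
  · rw [hdp x y h, hdp y x h.symm, hsymm x y h]
  · rw [hdp x y h, hdp y z h', hdp x z (h.trans h')]
    exact_mod_cast htri x y z h h'
  · rw [hdp x y (hx.trans hy.symm), hdp _ _ ((T.q_map j x hx).trans (T.q_map j y hy).symm),
      hinv p hp j x y hx hy]
  · rw [hdp x y h]; exact_mod_cast hpos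

/-! ### Groupoid actions -/

namespace TopGroupoid

variable {Γ : Type*} [TopologicalSpace Γ] (𝒢 : TopGroupoid Γ)

theorem s_inv (g : Γ) : 𝒢.s (𝒢.inv g) = 𝒢.r g := Subtype.ext (𝒢.mul_inv_eq g).symm

theorem r_inv (g : Γ) : 𝒢.r (𝒢.inv g) = 𝒢.s g :=
  Subtype.ext (𝒢.mul_congr rfl (𝒢.inv_inv g) _ _)

end TopGroupoid

namespace GroupoidAction

section

variable {Γ : Type*} [TopologicalSpace Γ] {𝒢 : TopGroupoid Γ} {K : Type*} [TopologicalSpace K]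
  (A : GroupoidAction 𝒢 K)

theorem act_inv (g : Γ) (y : K) (hy : 𝒢.r g = A.q y) :
    A.act ⟨(g, A.act ⟨(𝒢.inv g, y), (𝒢.s_inv g).trans hy⟩),
      (𝒢.r_inv g).symm.trans (A.q_act ⟨(𝒢.inv g, y), (𝒢.s_inv g).trans hy⟩).symm⟩ = y := by
  rw [← A.mul_act (𝒢.comp_inv g) y ((𝒢.s_inv g).trans hy)]
  refine Eq.trans ?_ (A.unit_act y)
  congr 3
  exact congrArg Subtype.val hy

open Classical in
/-- The fiber bijections given by a groupoid action. -/
noncomputable def moves : FiberMoves A.q Γ where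
  src := 𝒢.s
  tgt := 𝒢.r
  map g x := if h : 𝒢.s g = A.q x then A.act ⟨(g, x), h⟩ else x
  q_map g x hx := by rw [dif_pos hx.symm, A.q_act]
  surj g y hy := by
    have hq : A.q (A.act ⟨(𝒢.inv g, y), (𝒢.s_inv g).trans hy.symm⟩) = 𝒢.s g :=
      (A.q_act _).trans (𝒢.r_inv g)
    refine ⟨_, hq, ?_⟩
    rw [dif_pos hq.symm]
    exact A.act_inv g y hy.symm

theorem moves_map (g : Γ) (x : A.q ⁻¹' {𝒢.s g}) : A.moves.map g x = A.translate g x :=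
  dif_pos (show 𝒢.s g = A.q x from x.2.symm)

theorem moves_map_eq_act {g : Γ} {x : K} (hx : 𝒢.s g = A.q x) :
    A.moves.map g x = A.act ⟨(g, x), hx⟩ := dif_pos hx

theorem continuous_translate (g : Γ) : Continuous (A.translate g) :=
  A.continuous_act.comp (by fun_prop)

end

/-- The range of an invariant function f, acted on by the one-point groupoid, is a trivial factor
through f, so it is a point. `ULift` places it in the universe of `K`. -/
theorem TopologicallyErgodic.moves_ergodic.{u, v} {Γ : Type u} [TopologicalSpace Γ]
    {𝒢 : TopGroupoid Γ} {K : Type v} [TopologicalSpace K] [CompactSpace K]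
    {A : GroupoidAction 𝒢 K} (h : A.TopologicallyErgodic) : A.moves.Ergodic := by
  intro f hf x y
  have : CompactSpace (Set.range f) := isCompact_iff_compactSpace.1 (isCompact_range f.continuous)
  have : CompactSpace (ULift.{v} (Set.range f)) := Homeomorph.ulift.symm.compactSpace
  have hsub : Subsingleton (trivialGroupoid PUnit.{v + 1}).units := inferInstance
  let B : GroupoidAction (trivialGroupoid PUnit.{v + 1}) (ULift.{v} (Set.range f)) :=
  { q := fun _ => ⟨PUnit.unit, PUnit.unit, rfl⟩
    continuous_q := continuous_const
    isOpenMap_q := fun U _ => isOpen_discrete _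
    surjective_q := fun u => ⟨⟨⟨f x, x, rfl⟩⟩, Subsingleton.elim _ _⟩
    act := fun z => z.1.2
    continuous_act := continuous_snd.comp continuous_subtype_val
    q_act := fun _ => Subsingleton.elim _ _
    mul_act := fun _ _ _ => rfl
    unit_act := fun _ => rfl }
  let φ : FactorMap A B :=
  { p := fun x => ⟨⟨f x, x, rfl⟩⟩
    Φ := fun _ => PUnit.unit
    continuous_p := by fun_prop
    surjective_p := by
      rintro ⟨⟨_, x, rfl⟩⟩
      exact ⟨x, rfl⟩
    continuous_Φ := continuous_const
    surjective_Φ := fun _ => ⟨A.q x, rfl⟩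
    map_mul := fun _ => ⟨rfl, rfl⟩
    q_p := fun _ => rfl
    map_act := fun g x hx => ⟨Subsingleton.elim _ _, by
      have := hf g x hx.symm
      rw [A.moves_map_eq_act hx] at this
      exact congrArg ULift.up (Subtype.ext this)⟩ }
  obtain ⟨hM⟩ := h _ _ B φ
  have hxy : φ.p x = φ.p y := Subsingleton.elim _ _
  exact congrArg (fun z => z.down.1) hxy

theorem Pseudoisometric.moves_separates {Γ : Type*} [TopologicalSpace Γ] {𝒢 : TopGroupoid Γ}
    {K : Type*} [TopologicalSpace K] [CompactSpace K] [T2Space K] {A : GroupoidAction 𝒢 K}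
    (h : A.Pseudoisometric) : A.moves.Separates := by
  have := 𝒢.t2Space
  obtain ⟨P, hP, hinv⟩ := h
  refine A.moves.separates_of_generatesFibers A.continuous_q hP fun p hp g x y hx hy => ?_
  have h1 := hinv p hp g ⟨x, hx⟩ ⟨y, hy⟩
  rw [← h1]
  congr 3
  · exact A.moves_map g ⟨x, hx⟩
  · exact A.moves_map g ⟨y, hy⟩

section

variable {Γ : Type*} [TopologicalSpace Γ] {𝒢 : TopGroupoid Γ} {K : Type*} [TopologicalSpace K]
  [MeasurableSpace K] [BorelSpace K] (A : GroupoidAction 𝒢 K)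

theorem measurableSet_fiber (u : 𝒢.units) : MeasurableSet (A.q ⁻¹' {u}) := by
  have := 𝒢.t2Space
  exact (isClosed_singleton.preimage A.continuous_q).measurableSet

theorem integral_map_translate (g : Γ) {μ : Measure K} (hμ : μ (A.q ⁻¹' {𝒢.s g})ᶜ = 0)
    (f : C(K, ℝ)) :
    ∫ y, f y ∂(Measure.map (A.translate g) (Measure.comap Subtype.val μ)) =
      ∫ x, f (A.moves.map g x) ∂μ := by
  have hm : Measurable (A.translate g) := (A.continuous_translate g).measurable
  rw [integral_map hm.aemeasurable f.continuous.measurable.aestronglyMeasurable]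
  simp only [← A.moves_map]
  rw [integral_subtype_comap (A.measurableSet_fiber _) fun x => f (A.moves.map g x),
    Measure.restrict_eq_self_of_ae_mem (s := A.q ⁻¹' {𝒢.s g}) hμ]

theorem map_q_eq_dirac_iff (u : 𝒢.units) (μ : Measure K) [IsProbabilityMeasure μ] :
    @Measure.map K 𝒢.units _ (borel 𝒢.units) A.q μ = @Measure.dirac 𝒢.units (borel 𝒢.units) u ↔
      μ (A.q ⁻¹' {u})ᶜ = 0 := by
  have := 𝒢.t2Space
  let _ : MeasurableSpace 𝒢.units := borel 𝒢.units
  have : BorelSpace 𝒢.units := ⟨rfl⟩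
  constructor
  · intro h
    rw [← Set.preimage_compl, ← Measure.map_apply A.continuous_q.measurable
      (measurableSet_singleton u).compl, h]
    simp
  · intro h
    have hae : A.q =ᵐ[μ] fun _ => u := h
    rw [Measure.map_congr hae, Measure.map_const, measure_univ, one_smul]

variable [CompactSpace K] [T2Space K]

/-- Translation is defined on one fiber only, so regularity goes through inner regularity, which
survives restriction to the fiber and continuous images; a finite inner regular measure on `K` is
regular. -/
theorem regular_map_translate (g : Γ) (μ : Measure K) [μ.Regular] [IsFiniteMeasure μ] :
    (Measure.map (A.translate g)
      (Measure.comap (Subtype.val : A.q ⁻¹' {𝒢.s g} → K) μ)).Regular := by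
  have hme := MeasurableEmbedding.subtype_coe (A.measurableSet_fiber (𝒢.s g))
  have h1 : (Measure.comap (Subtype.val : A.q ⁻¹' {𝒢.s g} → K) μ).InnerRegular :=
    ⟨Measure.InnerRegularWRT.comap Measure.InnerRegular.innerRegular hme
      (fun U hU => hme.measurableSet_image.2 hU)
      fun C hC hCc => IsInducing.subtypeVal.isCompact_preimage' hCc hC⟩
  have h2 := Measure.InnerRegular.map_of_continuous (μ := Measure.comap
    (Subtype.val : A.q ⁻¹' {𝒢.s g} → K) μ) (A.continuous_translate g)
  infer_instance

/-- Invariant kernels see the translate of a uniform measure exactly as the original, so it is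
uniform over r g and agrees with the measure chosen there. Conversely, `Ergodic.isUniformMeasure`
identifies every relatively invariant measure. -/
theorem exists_unique_relInvMeasure (hA : A.Pseudoisometric) (hE : A.moves.Ergodic) :
    ∃ μ : 𝒢.units → RegularProb K, A.IsRelInvMeasure μ ∧ FullySupported A.q μ ∧
      ∀ ν : 𝒢.units → RegularProb K, A.IsRelInvMeasure ν → ν = μ := by
  have := 𝒢.t2Space
  obtain ⟨μ, hμc, hμs, hμu, huniq⟩ := hE.exists_uniformMeasure hA.moves_separates A.continuous_q
    A.isOpenMap_q A.surjective_q
  refine ⟨μ, ⟨hμc, fun u => (A.map_q_eq_dirac_iff u _).2 (hμu u).null, fun g => ?_⟩, hμs,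
    fun ν hν => funext fun u => huniq u _ ?_⟩
  · set ν := Measure.map (A.translate g) (Measure.comap Subtype.val (μ (𝒢.s g)).meas) with hν
    have : (μ (𝒢.s g)).meas.Regular := (μ (𝒢.s g)).2
    have hint : ∀ f : C(K, ℝ), ∫ y, f y ∂ν = ∫ x, f (A.moves.map g x) ∂(μ (𝒢.s g)).meas :=
      A.integral_map_translate g (hμu _).null
    have hprob : IsProbabilityMeasure ν := by
      have h1 := hint 1
      simp only [ContinuousMap.one_apply, integral_const, probReal_univ, smul_eq_mul, mul_one] at h1
      exact ⟨by simpa [Measure.real, ENNReal.toReal_eq_one_iff] using h1⟩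
    have hnull : ν (A.q ⁻¹' {𝒢.r g})ᶜ = 0 := by
      rw [hν, Measure.map_apply (A.continuous_translate g).measurable
        (A.measurableSet_fiber _).compl]
      convert measure_empty (μ := Measure.comap Subtype.val (μ (𝒢.s g)).meas)
      ext x
      simpa using A.q_translate g x
    have hunif : A.moves.IsUniformMeasure (𝒢.r g) ν := by
      refine ⟨hnull, fun k hk y y' hy hy' => ?_⟩
      obtain ⟨x, hx, rfl⟩ := A.moves.surj g y hy
      obtain ⟨x', hx', rfl⟩ := A.moves.surj g y' hy'
      have key : ∀ x, A.q x = 𝒢.s g → ∫ y, k.curry (A.moves.map g x) y ∂ν =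
          ∫ y, k.curry x y ∂(μ (𝒢.s g)).meas := by
        intro x hx
        rw [hint]
        refine integral_congr_ae ?_
        filter_upwards [show ∀ᵐ y ∂(μ (𝒢.s g)).meas, A.q y = 𝒢.s g from (hμu _).null] with y hy
        exact hk.preserves g x y hx hy
      dsimp only
      rw [key x hx, key x' hx']
      exact (hμu _).uniform k hk x x' hx hx'
    exact congrArg RegularProb.meas
      (huniq _ ⟨⟨ν, hprob⟩, A.regular_map_translate g (μ (𝒢.s g)).meas⟩ hunif)
  · have hnull : ∀ u, (ν u).meas (A.q ⁻¹' {u})ᶜ = 0 := fun u =>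
      (A.map_q_eq_dirac_iff u _).1 (hν.map_q u)
    refine hE.isUniformMeasure A.continuous_q hν.continuous hnull (fun g f => ?_) u
    exact (A.integral_map_translate g (hnull _) f).symm.trans (by rw [hν.map_translate g]; rfl)

end

end GroupoidAction

/-! ### Extensions of dynamical systems -/

namespace IsOpenExtension

variable {G K L : Type*} [Group G] [TopologicalSpace K] [TopologicalSpace L] [MulAction G K]
  [MulAction G L] {q : K → L}

/-- The fiber bijections given by an extension. -/
def moves (hq : IsOpenExtension G q) : FiberMoves q (G × L) where
  src j := j.2
  tgt j := j.1 • j.2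
  map j x := j.1 • x
  q_map j x hx := by rw [hq.map_smul, hx]
  surj j y hy := ⟨j.1⁻¹ • y, by rw [hq.map_smul, hy, inv_smul_smul], smul_inv_smul _ _⟩

theorem moves_ergodic (hq : IsOpenExtension G q) (h : TopologicallyErgodicSystem G K) :
    hq.moves.Ergodic := by
  intro f hf x y
  obtain ⟨c, hc⟩ := h ⟨fun x => (f x : ℂ), by fun_prop⟩ fun g x =>
    congrArg Complex.ofReal (hf (g⁻¹, q x) x rfl)
  exact Complex.ofReal_injective ((hc x).trans (hc y).symm)

variable [CompactSpace K] [T2Space K] [T2Space L]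

theorem Pseudoisometric.moves_separates {hq : IsOpenExtension G q} (h : hq.Pseudoisometric) :
    hq.moves.Separates := by
  obtain ⟨P, hP, hinv⟩ := h
  exact hq.moves.separates_of_generatesFibers hq.continuous hP fun p hp j x y hx hy =>
    hinv p hp j.1 x y (hx.trans hy.symm)

theorem exists_unique_relInvMeasure [TopologicalSpace G] [ContinuousSMul G K] [MeasurableSpace K]
    [BorelSpace K] (hq : IsOpenExtension G q) (hP : hq.Pseudoisometric)
    (hE : TopologicallyErgodicSystem G K) :
    ∃ μ : L → RegularProb K, IsRelInvMeasureExt G q μ ∧ FullySupported q μ ∧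
      ∀ ν : L → RegularProb K, IsRelInvMeasureExt G q ν → ν = μ := by
  have hE' := hq.moves_ergodic hE
  obtain ⟨μ, hμc, hμs, hμu, huniq⟩ := hE'.exists_uniformMeasure hP.moves_separates hq.continuous
    hq.isOpenMap hq.surjective
  have hmeas : ∀ g : G, Measurable fun x : K => g • x := fun g =>
    (continuous_const_smul g).measurable
  have hint : ∀ (g : G) (ν : Measure K) (f : C(K, ℝ)),
      ∫ y, f y ∂(Measure.map (fun x => g • x) ν) = ∫ x, f (g • x) ∂ν := fun g ν f =>
    integral_map (hmeas g).aemeasurable f.continuous.measurable.aestronglyMeasurable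
  refine ⟨μ, ⟨hμc, fun l => (hμs l).subset, fun g l => ?_⟩, hμs,
    fun ν hν => funext fun l => huniq l _ ?_⟩
  · set ν := Measure.map (fun x : K => g • x) (μ l).meas with hν
    have : (μ l).meas.Regular := (μ l).2
    have hprob : IsProbabilityMeasure ν := Measure.isProbabilityMeasure_map (hmeas g).aemeasurable
    have hreg : ν.Regular := Measure.Regular.map (Homeomorph.smul g)
    have hunif : hq.moves.IsUniformMeasure (g • l) ν := by
      refine ⟨?_, fun k hk y y' hy hy' => ?_⟩
      · rw [hν, Measure.map_apply (hmeas g)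
          (isClosed_singleton.preimage hq.continuous).measurableSet.compl]
        refine measure_mono_null (Set.compl_subset_compl.2 fun x hxl => ?_) (hμu l).null
        exact (hq.map_smul g x).trans (congrArg (g • ·) hxl)
      · obtain ⟨x, hx, rfl⟩ := hq.moves.surj (g, l) y hy
        obtain ⟨x', hx', rfl⟩ := hq.moves.surj (g, l) y' hy'
        have key : ∀ x, q x = l → ∫ y, k.curry (g • x) y ∂ν = ∫ y, k.curry x y ∂(μ l).meas := by
          intro x hx
          rw [hν, hint]
          refine integral_congr_ae ?_
          filter_upwards [show ∀ᵐ y ∂(μ l).meas, q y = l from (hμu l).null] with y hy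
          exact hk.preserves (g, l) x y hx hy
        exact (key x hx).trans (((hμu l).uniform k hk x x' hx hx').trans (key x' hx').symm)
    exact congrArg RegularProb.meas (huniq _ ⟨⟨ν, hprob⟩, hreg⟩ hunif)
  -- Regularity makes the complement of the support null, so the support condition means
  -- concentration on the fiber.
  · have hnull : ∀ l, (ν l).meas (q ⁻¹' {l})ᶜ = 0 := fun l => by
      have : (ν l).meas.Regular := (ν l).2
      exact measure_mono_null (Set.compl_subset_compl.2 (hν.support_subset l))
        Measure.measure_compl_support_of_regular
    refine hE'.isUniformMeasure hq.continuous hν.continuous hnull (fun j f => ?_) l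
    exact (hint j.1 _ f).symm.trans (by rw [hν.map_smul]; rfl)

end IsOpenExtension

/-! ### The theorem -/

theorem mainTheorem4 :
    (∀ {Γ : Type*} [TopologicalSpace Γ] (𝒢 : TopGroupoid Γ)
        {K : Type*} [TopologicalSpace K] [CompactSpace K] [T2Space K]
        [MeasurableSpace K] [BorelSpace K] (A : GroupoidAction 𝒢 K),
        A.Pseudoisometric → A.TopologicallyErgodic →
        ∃ μ : 𝒢.units → RegularProb K, A.IsRelInvMeasure μ ∧ FullySupported A.q μ ∧
          ∀ ν : 𝒢.units → RegularProb K, A.IsRelInvMeasure ν → ν = μ) ∧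
    (∀ {G : Type*} [Group G] [TopologicalSpace G] [IsTopologicalGroup G] [T2Space G]
        {K : Type*} [Nonempty K] [TopologicalSpace K] [CompactSpace K] [T2Space K]
        [MulAction G K] [ContinuousSMul G K] [MeasurableSpace K] [BorelSpace K]
        {L : Type*} [Nonempty L] [TopologicalSpace L] [CompactSpace L] [T2Space L]
        [MulAction G L] [ContinuousSMul G L]
        (q : K → L) (hq : IsOpenExtension G q),
        hq.Pseudoisometric → TopologicallyErgodicSystem G K → TopologicallyErgodicSystem G L →
        ∃ μ : L → RegularProb K, IsRelInvMeasureExt G q μ ∧ FullySupported q μ ∧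
          ∀ ν : L → RegularProb K, IsRelInvMeasureExt G q ν → ν = μ) := by
  refine ⟨?_, ?_⟩
  · intro Γ _ 𝒢 K _ _ _ _ _ A hA hE
    exact A.exists_unique_relInvMeasure hA hE.moves_ergodic
  · intro G _ _ _ _ K _ _ _ _ _ _ _ _ L _ _ _ _ _ _ q hq hP hE _
    exact hq.exists_unique_relInvMeasure hP hE
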